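/- A hypergraph $H$ consists of a finite vertex set $V(H)$ and a set $E(H)\subseteq 2^{V(H)}$ of edges. For $X\subseteq V(H)$ let $H-X$ be the hypergraph with vertex set $V(H)\setminus X$ and edge set $\{e\setminus X : e\in E(H)\}\setminus\{\emptyset\}$. A nest-set of $H$ is a non-empty set $s\subseteq V(H)$ such that $\{e\setminus s : e\in E(H),\ e\cap s\neq\emptyset\}$ is linearly ordered by $\subseteq$. A $k$-nest-set elimination ordering of $H$ is a sequence $(s_1,\dots,s_q)$ such that, with $H_0=H$ and $H_i=H_{i-1}-s_i$, each $s_i$ is a nest-set of $H_{i-1}$ with $|s_i|\le k$, and $H_q$ has no vertices. The nest-set width $\mathrm{nsw}(H)$ is the least $k$ for which such an ordering exists. For a propositional formula $F$ in conjunctive normal form (CNF), $H(F)$ is the hypergraph whose vertices are the variables occurring in $F$ and whose edges are the sets of variables of the clauses of $F$; put $\mathrm{nsw}(F)=\mathrm{nsw}(H(F))$. Let $|F|$ be the length of $F$ written as a word over a finite alphabet, with variables named by natural numbers in binary. **Theorem.** SAT for propositional CNF formulas is fixed-parameter tractable when parameterized by the nest-set width of the formula. That is, there are a computable function $f:\mathbb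 N\to\mathbb N$, a constant $c\in\mathbb N$ and a deterministic (multi-stack) Turing machine which, given any CNF formula $F$ (without the value $\mathrm{nsw}(F)$), decides whether $F$ is satisfiable and halts after at most $f(\mathrm{nsw}(F))\cdot(|F|+1)^c$ steps. -/

import Mathlib

namespace NestSetSAT

open scoped Hypergraph

section HypergraphWidth

variable {α : Type*}

/-- The edges of `H` that are incident to at least one vertex of `s`. -/
def incidentEdges (H : Hypergraph α) (s : Set α) : Set (Set α) :=
  {e | e ∈ E(H) ∧ ∃ v ∈ s, v ∈ e}

/-- The vertex-induced subhypergraph on `V(H) \ s`: the vertices of `s` are removed from the vertex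
set and from every edge, and edges that are empty afterwards are dropped. -/
def deleteVertices (H : Hypergraph α) (s : Set α) : Hypergraph α where
  vertexSet := V(H) \ s
  edgeSet := {e | e.Nonempty ∧ ∃ e' ∈ E(H), e = e' ∩ (V(H) \ s)}
  subset_vertexSet_of_mem_edgeSet' := by
    rintro e ⟨-, e', -, rfl⟩
    exact Set.inter_subset_right

/-- A nest-set of `H`: a non-empty set `s` of vertices such that the sets `e \ s`, for `e` an edge
incident to `s`, are linearly ordered by inclusion. -/
def IsNestSet (H : Hypergraph α) (s : Set α) : Prop :=
  s.Nonempty ∧ s ⊆ V(H) ∧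
    IsChain (· ⊆ ·) ((fun e : Set α => e \ s) '' incidentEdges H s)

/-- A nest-set elimination ordering of `H`: a sequence of sets each of which is a nest-set of what
is left of `H` after the deletion of the preceding ones, and which together exhaust the vertices
of `H`. (After at least one deletion no empty edge is left, so having no vertices then means
being the hypergraph without vertices and edges.) -/
def IsNEO (H : Hypergraph α) : List (Set α) → Prop
  | [] => V(H) = ∅
  | s :: O => IsNestSet H s ∧ IsNEO (deleteVertices H s) O

/-- A `k`-NEO: a nest-set elimination ordering all of whose sets have at most `k` elements. -/
def IsKNEO (H : Hypergraph α) (k : ℕ) (O : List (Set α)) : Prop :=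
  IsNEO H O ∧ ∀ s ∈ O, s.encard ≤ k

/-- The nest-set width of `H`: the least `k` for which `H` has a `k`-NEO. Every hypergraph with
finitely many vertices has one, see `exists_isKNEO`. -/
noncomputable def nestSetWidth (H : Hypergraph α) : ℕ :=
  sInf {k : ℕ | ∃ O : List (Set α), IsKNEO H k O}

/-- The set of all vertices is a nest-set, so the width of a finite hypergraph is a genuine
minimum. -/
theorem exists_isKNEO (H : Hypergraph α) (hV : V(H).Finite) :
    ∃ (k : ℕ) (O : List (Set α)), IsKNEO H k O := by
  rcases V(H).eq_empty_or_nonempty with h | h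
  · exact ⟨0, [], h, by simp⟩
  · refine ⟨V(H).ncard, [V(H)], ⟨⟨h, subset_rfl, ?_⟩, ?_⟩, ?_⟩
    · rintro _ ⟨e, he, rfl⟩ _ ⟨e', -, rfl⟩ -
      left
      intro x hx
      exact absurd (H.subset_vertexSet_of_mem_edgeSet' he.1 hx.1) hx.2
    · simp [IsNEO, deleteVertices]
    · simp [hV.cast_ncard_eq]

end HypergraphWidth

section Formulas

/-- A literal: a propositional variable together with its sign (`true` for the variable itself,
`false` for its negation). -/
abbrev Literal : Type := ℕ × Bool

/-- A clause, the disjunction of its literals. -/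
abbrev Clause : Type := List Literal

/-- A propositional formula in conjunctive normal form, the conjunction of its clauses. -/
abbrev CNF : Type := List Clause

/-- The truth assignment `τ` satisfies the formula `F`. -/
def Satisfies (τ : ℕ → Bool) (F : CNF) : Prop :=
  ∀ C ∈ F, ∃ l ∈ C, τ l.1 = l.2

/-- Membership in the language SAT. -/
def Satisfiable (F : CNF) : Prop :=
  ∃ τ : ℕ → Bool, Satisfies τ F

/-- The variables that occur in a clause. -/
def clauseVars (C : Clause) : Set ℕ :=
  {v | ∃ l ∈ C, l.1 = v}

/-- The hypergraph of a formula: its vertices are the variables that occur in the formula, its edges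
are the variable sets of the clauses. -/
def formulaHypergraph (F : CNF) : Hypergraph ℕ where
  vertexSet := {v | ∃ C ∈ F, v ∈ clauseVars C}
  edgeSet := {e | ∃ C ∈ F, e = clauseVars C}
  subset_vertexSet_of_mem_edgeSet' := by
    rintro e ⟨C, hC, rfl⟩ v hv
    exact ⟨C, hC, hv⟩

/-- The nest-set width of a formula. -/
noncomputable def formulaWidth (F : CNF) : ℕ :=
  nestSetWidth (formulaHypergraph F)

/-- The alphabet over which formulas are written down. -/
inductive Symbol : Type
  | positive
  | negative
  | bit (b : Bool)
  | clauseEnd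

/-- A literal is written as its sign followed by the binary digits of its variable. -/
def encodeLiteral (l : Literal) : List Symbol :=
  (if l.2 then Symbol.positive else Symbol.negative) :: (Nat.bits l.1).map Symbol.bit

/-- A clause is written as the sequence of its literals followed by an end marker. -/
def encodeClause (C : Clause) : List Symbol :=
  C.flatMap encodeLiteral ++ [Symbol.clauseEnd]

/-- A formula is written as the sequence of its clauses. The size of a formula is the length of
this word. -/
def encodeCNF (F : CNF) : List Symbol :=
  F.flatMap encodeClause

end Formulas

section Complexity

/-- The decision problem `L` on instances of type `I`, written as words over the alphabet `Γ` by
`enc`, is fixed-parameter tractable with respect to the parameter `κ`: there are a computable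
function `f`, a constant `c` and one Turing machine (with finitely many stacks) which on every
instance `x` halts with the correct answer after at most `f (κ x) * (|enc x| + 1) ^ c` steps. The
machine is given the instance only, not the value of the parameter. -/
def IsFixedParameterTractable {I Γ : Type} (enc : I → List Γ) (L : I → Prop) (κ : I → ℕ) : Prop :=
  ∃ (M : Turing.TM2ComputableAux Γ Bool) (f : ℕ → ℕ) (c : ℕ), Computable f ∧
    ∀ x : I, ∃ answer : Bool, (answer = true ↔ L x) ∧
      Nonempty (Turing.TM2OutputsInTime M.tm
        ((enc x).map M.inputAlphabet.symm)
        (some ([answer].map M.outputAlphabet.symm))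
        (f (κ x) * ((enc x).length + 1) ^ c))

end Complexity

end NestSetSAT

/-! The combinatorial core is a Davis–Putnam elimination of a whole nest-set `s` at once. Call a
clause total if it has exactly one literal of each variable in `s`. The restriction `D` of a clause
of `F` to the variables outside `s` is kept by `elim` iff for every total clause `a` some clause of
`F` is contained in `a ∪ D`. Every kept `D` follows from `F`. Conversely, let `τ` satisfy all kept
restrictions and suppose that `F` is unsatisfiable. For each `a`, the assignment that falsifies `a`
on `s` and agrees with `τ` elsewhere violates a clause `C a`: its literals on `s` lie in `a`, the
others are false under `τ`. So the restriction of `C a` is not kept, which forces `C a` to meet `s`.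
As `s` is a nest-set, the variable sets of the `C a` outside `s` form a chain. Let `D` be the
restriction of a `C b` for which this set is largest. Signs outside `s` are dictated by `τ`, so `C a
⊆ a ∪ D` for all `a`; hence `D` is kept although `τ` falsifies it, a contradiction
(`satisfiable_elim_iff`). The formula never grows, since only restrictions of old clauses remain,
and its width does not grow either (`IsPart.exists_isKNEO`, `HasNEO.elim`).

A nest-set is found by a bounded search tree. If two edges incident to `s` have vertices `x` and `y`
outside `s`, each missing from the other edge, then every nest-set that includes `s` contains `x` or
`y` (`mem_or_mem_of_isNestSet`). Branching from all singletons, with size bounds 1, 2, and so on,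
succeeds at the latest when the bound reaches the width, so the width need not be known. `Inv.step`
shows that an invariant is kept and that a potential, initially polynomial in `|F|` and `3 ^ width`,
decreases.

For the machine, structured stack programs are compiled with exact step counts (`run_code`). On top
of them stands a calculus `PT` of polynomial-time functions on binary trees, closed under
composition, case distinction and folds with bounded accumulators. One step of the algorithm lies in
`PT`, and `computes_while` iterates it. All quantities are polynomial in `4 ^ (width + 1) * (|F| +
1)`, a product that separates the parameter from the length. -/

namespace StackProg

/-! ### Structured stack programs and their compilation -/

open Turing Function

/-- Structured programs acting on finitely many stacks and a finite memory `σ`. -/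
inductive Prog {K : Type} (Γ : K → Type) (σ : Type) : Type
  | push (k : K) (f : σ → Γ k)
  | pop (k : K) (f : σ → Option (Γ k) → σ)
  | load (f : σ → σ)
  | seq (p q : Prog Γ σ)
  | ite (b : σ → Bool) (p q : Prog Γ σ)
  | loop (b : σ → Bool) (p : Prog Γ σ)

variable {K : Type} [DecidableEq K] {Γ : K → Type} {σ : Type}

/-- `Run p v S n v' S'`: started with memory `v` and stacks `S`, the program `p` ends after exactly
`n` steps with memory `v'` and stacks `S'`. -/
inductive Run : Prog Γ σ → σ → (∀ k, List (Γ k)) → ℕ → σ → (∀ k, List (Γ k)) → Prop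
  | push (k : K) (f : σ → Γ k) (v S) : Run (.push k f) v S 1 v (update S k (f v :: S k))
  | pop (k : K) (f : σ → Option (Γ k) → σ) (v S) :
      Run (.pop k f) v S 1 (f v (S k).head?) (update S k (S k).tail)
  | load (f : σ → σ) (v S) : Run (.load f) v S 1 (f v) S
  | seq {p q v S n v₁ S₁ m v₂ S₂} : Run p v S n v₁ S₁ → Run q v₁ S₁ m v₂ S₂ →
      Run (.seq p q) v S (n + m) v₂ S₂
  | ite_true {b : σ → Bool} {p q v S n v' S'} : b v = true → Run p v S n v' S' →
      Run (.ite b p q) v S (n + 1) v' S'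
  | ite_false {b : σ → Bool} {p q v S n v' S'} : b v = false → Run q v S n v' S' →
      Run (.ite b p q) v S (n + 1) v' S'
  | loop_done {b : σ → Bool} {p v S} : b v = false → Run (.loop b p) v S 1 v S
  | loop_step {b : σ → Bool} {p v S n v₁ S₁ m v₂ S₂} : b v = true → Run p v S n v₁ S₁ →
      Run (.loop b p) v₁ S₁ m v₂ S₂ → Run (.loop b p) v S (n + m + 1) v₂ S₂

namespace Prog

/-- The labels of the machine that executes a program. -/
def Label : Prog Γ σ → Type
  | push _ _ => Unit
  | pop _ _ => Unit
  | load _ => Unit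
  | seq p q => Label p ⊕ Label q
  | ite _ p q => Option (Label p ⊕ Label q)
  | loop _ p => Option (Label p)

/-- There are finitely many labels. -/
@[reducible]
def fintypeLabel : (p : Prog Γ σ) → Fintype (Label p)
  | push _ _ => inferInstanceAs (Fintype Unit)
  | pop _ _ => inferInstanceAs (Fintype Unit)
  | load _ => inferInstanceAs (Fintype Unit)
  | seq p q =>
    letI := fintypeLabel p
    letI := fintypeLabel q
    inferInstanceAs (Fintype (Label p ⊕ Label q))
  | ite _ p q =>
    letI := fintypeLabel p
    letI := fintypeLabel q
    inferInstanceAs (Fintype (Option (Label p ⊕ Label q)))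
  | loop _ p =>
    letI := fintypeLabel p
    inferInstanceAs (Fintype (Option (Label p)))

/-- The label at which the execution starts. -/
def entry : (p : Prog Γ σ) → Label p
  | push _ _ => ()
  | pop _ _ => ()
  | load _ => ()
  | seq p _ => Sum.inl (entry p)
  | ite _ _ _ => none
  | loop _ _ => none

/-- The translation into statements for a machine with label set `Λ`; `exit` is executed when the
program has ended. -/
def code {Λ : Type} : (p : Prog Γ σ) → (Label p → Λ) → TM2.Stmt Γ Λ σ → Label p → TM2.Stmt Γ Λ σ
  | push k f, _, exit => fun _ => .push k f exit
  | pop k f, _, exit => fun _ => .pop k f exit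
  | load f, _, exit => fun _ => .load f exit
  | seq p q, emb, exit => fun l => match l with
    | Sum.inl l => code p (fun l => emb (Sum.inl l)) (.goto fun _ => emb (Sum.inr (entry q))) l
    | Sum.inr l => code q (fun l => emb (Sum.inr l)) exit l
  | ite b p q, emb, exit => fun l => match l with
    | none => .branch b (.goto fun _ => emb (some (Sum.inl (entry p))))
        (.goto fun _ => emb (some (Sum.inr (entry q))))
    | some (Sum.inl l) => code p (fun l => emb (some (Sum.inl l))) exit l
    | some (Sum.inr l) => code q (fun l => emb (some (Sum.inr l))) exit l
  | loop b p, emb, exit => fun l => match l with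
    | none => .branch b (.goto fun _ => emb (some (entry p))) exit
    | some l => code p (fun l => emb (some l)) (.goto fun _ => emb none) l

end Prog

/-- The embedding `emb` and the continuation `exit` are arbitrary because the induction meets `p` as
a piece of a larger machine. The continuation is executed within the machine step that completes
`p`, so sequencing costs nothing and the step counts agree exactly. -/
theorem run_code {Λ : Type} (M : Λ → TM2.Stmt Γ Λ σ) {p : Prog Γ σ} {v S n v' S'}
    (h : Run p v S n v' S') : ∀ (emb : p.Label → Λ) (exit : TM2.Stmt Γ Λ σ),
    (∀ l, M (emb l) = p.code emb exit l) →
    (flip bind (TM2.step M))^[n] (some ⟨some (emb p.entry), v, S⟩) =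
      some (TM2.stepAux exit v' S') := by
  have hstep : ∀ (l : Λ) v S, flip bind (TM2.step M) (some ⟨some l, v, S⟩) =
      some (TM2.stepAux (M l) v S) := fun _ _ _ => rfl
  induction h with intro emb exit hM
  | push k f v S => rw [iterate_one, hstep, hM]; rfl
  | pop k f v S => rw [iterate_one, hstep, hM]; rfl
  | load f v S => rw [iterate_one, hstep, hM]; rfl
  | seq _ _ ihp ihq =>
    rw [Nat.add_comm, iterate_add_apply]
    have := ihp (fun l => emb (Sum.inl l)) _ (fun l => hM (Sum.inl l))
    refine (congrArg _ this).trans ?_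
    exact ihq (fun l => emb (Sum.inr l)) exit (fun l => hM (Sum.inr l))
  | ite_true hb _ ih =>
    rw [iterate_succ_apply, hstep, hM]
    simp only [Prog.entry, Prog.code, TM2.stepAux, hb, cond_true]
    exact ih (fun l => emb (some (Sum.inl l))) exit (fun l => hM (some (Sum.inl l)))
  | ite_false hb _ ih =>
    rw [iterate_succ_apply, hstep, hM]
    simp only [Prog.entry, Prog.code, TM2.stepAux, hb, cond_false]
    exact ih (fun l => emb (some (Sum.inr l))) exit (fun l => hM (some (Sum.inr l)))
  | loop_done hb =>
    rw [iterate_one, hstep, hM]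
    simp only [Prog.entry, Prog.code, TM2.stepAux, hb, cond_false]
  | @loop_step b p v S n v₁ S₁ m v₂ S₂ hb _ _ ihp ihl =>
    rw [iterate_succ_apply, hstep, hM]
    simp only [Prog.entry, Prog.code, TM2.stepAux, hb, cond_true]
    rw [Nat.add_comm n m, iterate_add_apply]
    have := ihp (fun l => emb (some l)) _ (fun l => hM (some l))
    refine (congrArg _ this).trans ?_
    exact ihl emb exit hM

/-- The machine that executes a program. -/
def machine [Fintype K] [Fintype σ] (k₀ k₁ : K) [Fintype (Γ k₀)] (v₀ : σ) (p : Prog Γ σ) :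
    FinTM2 where
  K := K
  k₀ := k₀
  k₁ := k₁
  Γ := Γ
  Λ := p.Label
  main := p.entry
  ΛFin := p.fintypeLabel
  σ := σ
  initialState := v₀
  m := p.code id .halt

theorem initList_eq (tm : FinTM2) (l : List (tm.Γ tm.k₀)) :
    initList tm l = ⟨some tm.main, tm.initialState, update (fun _ => []) tm.k₀ l⟩ := by
  unfold initList
  congr 1
  funext k
  by_cases hk : k = tm.k₀
  · subst hk; simp
  · simp [hk]

theorem haltList_eq (tm : FinTM2) (l : List (tm.Γ tm.k₁)) :
    haltList tm l = ⟨none, tm.initialState, update (fun _ => []) tm.k₁ l⟩ := by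
  unfold haltList
  congr 1
  funext k
  by_cases hk : k = tm.k₁
  · subst hk; simp
  · simp [hk]

/-- A halting configuration in the sense of `haltList` has the initial memory and no stack content
besides the output; hence `v₀` at both ends of the run. -/
theorem machine_outputs [Fintype K] [Fintype σ] {k₀ k₁ : K} [Fintype (Γ k₀)] {v₀ : σ}
    {p : Prog Γ σ} {l : List (Γ k₀)} {l' : List (Γ k₁)} {n m : ℕ}
    (h : Run p v₀ (update (fun _ => []) k₀ l) n v₀ (update (fun _ => []) k₁ l')) (hn : n ≤ m) :
    Nonempty (TM2OutputsInTime (machine k₀ k₁ v₀ p) l (some l') m) := by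
  have key := run_code (p.code id .halt) h id .halt (fun _ => rfl)
  refine ⟨⟨⟨n, ?_⟩, hn⟩⟩
  have h1 := initList_eq (machine k₀ k₁ v₀ p) l
  have h2 := haltList_eq (machine k₀ k₁ v₀ p) l'
  refine (congrArg _ (congrArg some h1)).trans (key.trans ?_)
  exact (congrArg some h2).symm

end StackProg

/-! ### Working stacks, trees and their prefix codes -/

namespace StackProg

open Turing Function NestSetSAT

noncomputable instance fintypeSymbol : Fintype Symbol :=
  haveI : DecidableEq Symbol := Classical.decEq _
  ⟨{.positive, .negative, .bit false, .bit true, .clauseEnd}, fun s => by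
    rcases s with _ | _ | (_ | _) | _ <;> simp⟩

/-- The stacks: an input stack, an output stack, and five working stacks. -/
abbrev Stack : Type := Bool ⊕ Fin 5

/-- The alphabets of the stacks. On the working stacks, `none` is a delimiter. -/
abbrev Alphabet : Stack → Type
  | Sum.inl false => Symbol
  | Sum.inl true => Bool
  | Sum.inr _ => Option Bool

/-- The memory: two symbols of working stacks, a symbol of the input, and a flag. -/
abbrev Mem : Type := Option (Option Bool) × Option (Option Bool) × Option Symbol × Bool

/-- Programs over the fixed stacks and memory. -/
abbrev P : Type := Prog Alphabet Mem

/-- The stack contents, stack by stack. -/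
def mk (I : List Symbol) (O : List Bool) (A S T U C : List (Option Bool)) :
    ∀ k, List (Alphabet k)
  | Sum.inl false => I
  | Sum.inl true => O
  | Sum.inr 0 => A
  | Sum.inr 1 => S
  | Sum.inr 2 => T
  | Sum.inr 3 => U
  | Sum.inr 4 => C

section
variable (I : List Symbol) (O : List Bool) (A S T U C x : List (Option Bool))

theorem update_inp (y : List Symbol) :
    update (mk I O A S T U C) (Sum.inl false) y = mk y O A S T U C := by
  funext k; rcases k with (_ | _) | k <;> [rfl; rfl; skip]; fin_cases k <;> rfl
theorem update_out (y : List Bool) :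
    update (mk I O A S T U C) (Sum.inl true) y = mk I y A S T U C := by
  funext k; rcases k with (_ | _) | k <;> [rfl; rfl; skip]; fin_cases k <;> rfl
theorem update_zero : update (mk I O A S T U C) (Sum.inr 0) x = mk I O x S T U C := by
  funext k; rcases k with (_ | _) | k <;> [rfl; rfl; skip]; fin_cases k <;> rfl
theorem update_one : update (mk I O A S T U C) (Sum.inr 1) x = mk I O A x T U C := by
  funext k; rcases k with (_ | _) | k <;> [rfl; rfl; skip]; fin_cases k <;> rfl
theorem update_two : update (mk I O A S T U C) (Sum.inr 2) x = mk I O A S x U C := by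
  funext k; rcases k with (_ | _) | k <;> [rfl; rfl; skip]; fin_cases k <;> rfl
theorem update_three : update (mk I O A S T U C) (Sum.inr 3) x = mk I O A S T x C := by
  funext k; rcases k with (_ | _) | k <;> [rfl; rfl; skip]; fin_cases k <;> rfl
theorem update_four : update (mk I O A S T U C) (Sum.inr 4) x = mk I O A S T U x := by
  funext k; rcases k with (_ | _) | k <;> [rfl; rfl; skip]; fin_cases k <;> rfl

theorem mk_nil : mk [] [] [] [] [] [] [] = fun _ => [] := by
  funext k; rcases k with (_ | _) | k <;> [rfl; rfl; skip]; fin_cases k <;> rfl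

end

/-- `Runs p S S' n`: with any initial memory, `p` leads from `S` to `S'` in at most `n` steps. -/
def Runs (p : P) (S S' : ∀ k, List (Alphabet k)) (n : ℕ) : Prop :=
  ∀ v, ∃ m ≤ n, ∃ v', Run p v S m v' S'

theorem Runs.mono {p : P} {S S' n m} (h : Runs p S S' n) (hnm : n ≤ m) : Runs p S S' m := fun v =>
  let ⟨k, hk, r⟩ := h v
  ⟨k, hk.trans hnm, r⟩

theorem Runs.seq {p q : P} {S₀ S₁ S₂ n m} (hp : Runs p S₀ S₁ n) (hq : Runs q S₁ S₂ m) :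
    Runs (.seq p q) S₀ S₂ (n + m) := fun v => by
  obtain ⟨k, hk, v₁, h₁⟩ := hp v
  obtain ⟨l, hl, v₂, h₂⟩ := hq v₁
  exact ⟨k + l, by omega, v₂, .seq h₁ h₂⟩

/-- Pop a symbol of a working stack into the first register. -/
def popw (i : Fin 5) : P := .pop (Sum.inr i) (fun v x => (x, v.2))

/-- Pop a symbol of a working stack into the second register. -/
def popw' (i : Fin 5) : P := .pop (Sum.inr i) (fun v x => (v.1, x, v.2.2))

/-- Push the first register on a working stack. -/
def pushr (i : Fin 5) : P := .push (Sum.inr i) (fun v => v.1.getD none)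

/-- Push a fixed symbol on a working stack. -/
def pushc (i : Fin 5) (x : Option Bool) : P := .push (Sum.inr i) (fun _ => x)

/-- Is the first register a proper symbol? -/
def isBit (v : Mem) : Bool := v.1.isSome && v.1 != some none

/-- Pop the symbols of a working stack down to a delimiter, performing an action for each. -/
def drain (i : Fin 5) (act : P) : P := .seq (popw i) (.loop isBit (.seq act (popw i)))

/-- In `G d x` the drained stack holds `x`, and `d` records what the action has deposited. Leaving
`G` open covers moving, copying (`d` on two stacks) and clearing (`d` ignored) at once. Words arrive
reversed. By `hr` the bottom of the stack serves as a delimiter too. Each symbol costs `m` steps for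
the action, one for the pop and one for the loop test. -/
theorem runs_drain {i : Fin 5} {act : P} {m : ℕ}
    (G : List (Option Bool) → List (Option Bool) → ∀ k, List (Alphabet k))
    (hG : ∀ d x, G d x (Sum.inr i) = x) (hu : ∀ d x y, update (G d x) (Sum.inr i) y = G d y)
    (hact : ∀ b d x q, ∃ v', Run act (some (some b), q) (G d x) m v' (G (some b :: d) x))
    (l : List Bool) (r : List (Option Bool)) (hr : r.head? = none ∨ r.head? = some none)
    (d : List (Option Bool)) :
    Runs (drain i act) (G d (l.map some ++ r)) (G ((l.map some).reverse ++ d) r.tail)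
      ((m + 2) * l.length + 2) := by
  have pop : ∀ d x v, Run (popw i) v (G d x) 1 (x.head?, v.2) (G d x.tail) := by
    intro d x v
    have := Run.pop (Γ := Alphabet) (Sum.inr i) (fun (v : Mem) x => (x, v.2)) v (G d x)
    rw [hG, hu] at this
    exact this
  have key : ∀ (l : List Bool) d q, ∃ n ≤ (m + 2) * l.length + 1, ∃ v',
      Run (.loop isBit (.seq act (popw i))) ((l.map some ++ r).head?, q)
        (G d (l.map some ++ r).tail) n v' (G ((l.map some).reverse ++ d) r.tail) := by
    intro l
    induction l with
    | nil =>
      intro d q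
      refine ⟨1, by simp, _, .loop_done ?_⟩
      rcases hr with h | h <;> simp [isBit, h]
    | cons b l ih =>
      intro d q
      obtain ⟨v₁, h₁⟩ := hact b d (l.map some ++ r) q
      obtain ⟨n, hn, v₂, h₂⟩ := ih (some b :: d) v₁.2
      refine ⟨m + 1 + n + 1, ?_, v₂, ?_⟩
      · simp only [List.length_cons, Nat.mul_succ]; omega
      · have := Run.loop_step (b := isBit) (v := (some (some b), q)) rfl
          (.seq h₁ (pop (some b :: d) (l.map some ++ r) v₁)) h₂
        simpa using this
  intro v
  obtain ⟨n, hn, v', h⟩ := key l d v.2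
  exact ⟨1 + n, by omega, v', .seq (pop _ _ _) h⟩

/-- Binary trees, the values of computations. -/
inductive Tr : Type
  | leaf
  | node (x y : Tr)
  deriving DecidableEq

namespace Tr

/-- The prefix code of a tree. -/
def code : Tr → List Bool
  | leaf => [false]
  | node x y => true :: (code x ++ code y)

/-- The number of nodes of a tree. -/
def size : Tr → ℕ
  | leaf => 1
  | node x y => size x + size y + 1

theorem length_code (x : Tr) : x.code.length = x.size := by
  induction x with
  | leaf => rfl
  | node x y hx hy => simp [code, size, hx, hy]

theorem size_pos (x : Tr) : 0 < x.size := by cases x <;> simp [size]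

/-- A prefix code shows by itself where it ends; the arbitrary tails are what the induction needs to
pass from the first subtree to the second. -/
theorem code_append_inj {x y : Tr} {l l' : List Bool} (h : x.code ++ l = y.code ++ l') :
    x = y ∧ l = l' := by
  induction x generalizing y l l' with
  | leaf => cases y with
    | leaf => simpa [code] using h
    | node => simp [code] at h
  | node a b ha hb => cases y with
    | leaf => simp [code] at h
    | node c d =>
      simp only [code, List.cons_append, List.append_assoc, List.cons.injEq, true_and] at h
      obtain ⟨h₁, h⟩ := ha h
      obtain ⟨h₂, h⟩ := hb h
      exact ⟨by rw [h₁, h₂], h⟩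

theorem code_injective : Injective code := fun x y h =>
  (code_append_inj (l := []) (l' := []) (by simpa using h)).1

/-- The tree that represents a truth value. -/
def ofBool : Bool → Tr
  | false => leaf
  | true => node leaf leaf

theorem size_ofBool (b : Bool) : (ofBool b).size ≤ 3 := by cases b <;> simp [ofBool, size]

/-- The prefix code on a working stack. -/
def stk (x : Tr) : List (Option Bool) := x.code.map some

end Tr

/-! ### Moving, copying and clearing words -/

section Moves
variable (I : List Symbol) (O : List Bool) (A S T U C R : List (Option Bool))

theorem run_pushr_zero (v : Mem) : Run (pushr 0) v (mk I O A S T U C) 1 v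
    (mk I O (v.1.getD none :: A) S T U C) := by
  have := Run.push (Γ := Alphabet) (Sum.inr 0) (fun v : Mem => v.1.getD none) v
    (mk I O A S T U C)
  rw [update_zero] at this
  exact this

theorem run_pushr_one (v : Mem) : Run (pushr 1) v (mk I O A S T U C) 1 v
    (mk I O A (v.1.getD none :: S) T U C) := by
  have := Run.push (Γ := Alphabet) (Sum.inr 1) (fun v : Mem => v.1.getD none) v
    (mk I O A S T U C)
  rw [update_one] at this
  exact this

theorem run_pushr_two (v : Mem) : Run (pushr 2) v (mk I O A S T U C) 1 v
    (mk I O A S (v.1.getD none :: T) U C) := by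
  have := Run.push (Γ := Alphabet) (Sum.inr 2) (fun v : Mem => v.1.getD none) v
    (mk I O A S T U C)
  rw [update_two] at this
  exact this

theorem run_pushr_three (v : Mem) : Run (pushr 3) v (mk I O A S T U C) 1 v
    (mk I O A S T (v.1.getD none :: U) C) := by
  have := Run.push (Γ := Alphabet) (Sum.inr 3) (fun v : Mem => v.1.getD none) v
    (mk I O A S T U C)
  rw [update_three] at this
  exact this

theorem runs_move02 (x : List Bool) :
    Runs (drain 0 (pushr 2)) (mk I O (x.map some) S T U C)
      (mk I O [] S ((x.map some).reverse ++ T) U C) (3 * x.length + 2) := by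
  have := runs_drain (i := 0) (act := pushr 2) (m := 1) (fun d x => mk I O x S d U C)
    (fun _ _ => rfl) (fun _ _ _ => update_zero ..)
    (fun b d x q => ⟨(some (some b), q), run_pushr_two ..⟩) x [] (by simp) T
  simpa using this

theorem runs_move03 (x : List Bool) :
    Runs (drain 0 (pushr 3)) (mk I O (x.map some) S T U C)
      (mk I O [] S T ((x.map some).reverse ++ U) C) (3 * x.length + 2) := by
  have := runs_drain (i := 0) (act := pushr 3) (m := 1) (fun d x => mk I O x S T d C)
    (fun _ _ => rfl) (fun _ _ _ => update_zero ..)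
    (fun b d x q => ⟨(some (some b), q), run_pushr_three ..⟩) x [] (by simp) U
  simpa using this

theorem runs_move12 (x : List Bool) :
    Runs (drain 1 (pushr 2)) (mk I O A (x.map some ++ none :: R) T U C)
      (mk I O A R ((x.map some).reverse ++ T) U C) (3 * x.length + 2) := by
  have := runs_drain (i := 1) (act := pushr 2) (m := 1) (fun d x => mk I O A x d U C)
    (fun _ _ => rfl) (fun _ _ _ => update_one ..)
    (fun b d x q => ⟨(some (some b), q), run_pushr_two ..⟩) x (none :: R) (by simp) T
  simpa using this

theorem runs_move13 (x : List Bool) :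
    Runs (drain 1 (pushr 3)) (mk I O A (x.map some ++ none :: R) T U C)
      (mk I O A R T ((x.map some).reverse ++ U) C) (3 * x.length + 2) := by
  have := runs_drain (i := 1) (act := pushr 3) (m := 1) (fun d x => mk I O A x T d C)
    (fun _ _ => rfl) (fun _ _ _ => update_one ..)
    (fun b d x q => ⟨(some (some b), q), run_pushr_three ..⟩) x (none :: R) (by simp) U
  simpa using this

theorem runs_move20 (x : List Bool) :
    Runs (drain 2 (pushr 0)) (mk I O A S (x.map some) U C)
      (mk I O ((x.map some).reverse ++ A) S [] U C) (3 * x.length + 2) := by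
  have := runs_drain (i := 2) (act := pushr 0) (m := 1) (fun d x => mk I O d S x U C)
    (fun _ _ => rfl) (fun _ _ _ => update_two ..)
    (fun b d x q => ⟨(some (some b), q), run_pushr_zero ..⟩) x [] (by simp) A
  simpa using this

theorem runs_move21 (x : List Bool) :
    Runs (drain 2 (pushr 1)) (mk I O A S (x.map some) U C)
      (mk I O A ((x.map some).reverse ++ S) [] U C) (3 * x.length + 2) := by
  have := runs_drain (i := 2) (act := pushr 1) (m := 1) (fun d x => mk I O A d x U C)
    (fun _ _ => rfl) (fun _ _ _ => update_two ..)
    (fun b d x q => ⟨(some (some b), q), run_pushr_one ..⟩) x [] (by simp) S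
  simpa using this

theorem runs_move30 (x : List Bool) :
    Runs (drain 3 (pushr 0)) (mk I O A S T (x.map some) C)
      (mk I O ((x.map some).reverse ++ A) S T [] C) (3 * x.length + 2) := by
  have := runs_drain (i := 3) (act := pushr 0) (m := 1) (fun d x => mk I O d S T x C)
    (fun _ _ => rfl) (fun _ _ _ => update_three ..)
    (fun b d x q => ⟨(some (some b), q), run_pushr_zero ..⟩) x [] (by simp) A
  simpa using this

theorem runs_copy (x : List Bool) :
    Runs (drain 2 (.seq (pushr 0) (pushr 1))) (mk I O [] S (x.map some) U C)
      (mk I O (x.map some).reverse ((x.map some).reverse ++ S) [] U C) (4 * x.length + 2) := by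
  have := runs_drain (i := 2) (act := .seq (pushr 0) (pushr 1)) (m := 2)
    (fun d x => mk I O d (d ++ S) x U C)
    (fun _ _ => rfl) (fun _ _ _ => update_two ..)
    (fun b d x q => ⟨(some (some b), q), .seq (run_pushr_zero ..) (run_pushr_one ..)⟩) x [] (by simp) []
  simpa using this

theorem runs_clear0 (x : List Bool) :
    Runs (drain 0 (.load id)) (mk I O (x.map some) S T U C) (mk I O [] S T U C)
      (3 * x.length + 2) := by
  have := runs_drain (i := 0) (act := .load id) (m := 1) (fun _ x => mk I O x S T U C)
    (fun _ _ => rfl) (fun _ _ _ => update_zero ..) (fun b d x q => ⟨_, .load ..⟩) x [] (by simp) []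
  simpa using this

theorem runs_clear2 (x : List Bool) :
    Runs (drain 2 (.load id)) (mk I O A S (x.map some) U C) (mk I O A S [] U C)
      (3 * x.length + 2) := by
  have := runs_drain (i := 2) (act := .load id) (m := 1) (fun _ x => mk I O A S x U C)
    (fun _ _ => rfl) (fun _ _ _ => update_two ..) (fun b d x q => ⟨_, .load ..⟩) x [] (by simp) []
  simpa using this

theorem runs_pushc0 (x : Option Bool) :
    Runs (pushc 0 x) (mk I O A S T U C) (mk I O (x :: A) S T U C) 1 := fun v => by
  have := Run.push (Γ := Alphabet) (Sum.inr 0) (fun _ : Mem => x) v (mk I O A S T U C)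
  rw [update_zero] at this
  exact ⟨1, le_rfl, v, this⟩

theorem runs_pushc1 (x : Option Bool) :
    Runs (pushc 1 x) (mk I O A S T U C) (mk I O A (x :: S) T U C) 1 := fun v => by
  have := Run.push (Γ := Alphabet) (Sum.inr 1) (fun _ : Mem => x) v (mk I O A S T U C)
  rw [update_one] at this
  exact ⟨1, le_rfl, v, this⟩

theorem run_popw0 (v : Mem) :
    Run (popw 0) v (mk I O A S T U C) 1 (A.head?, v.2) (mk I O A.tail S T U C) := by
  have := Run.pop (Γ := Alphabet) (Sum.inr 0) (fun (v : Mem) x => (x, v.2)) v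
    (mk I O A S T U C)
  rw [update_zero] at this
  exact this

end Moves

end StackProg

/-! ### Programs that transform trees -/

namespace StackProg

open Turing Function NestSetSAT

theorem Tr.reverse_stk_reverse (x : Tr) : (x.code.reverse.map some).reverse = x.stk := by
  simp [Tr.stk]

section Saving
variable (I : List Symbol) (R : List (Option Bool)) (x y : Tr)

/-- Put a copy of the current value on the second stack. -/
def save : P :=
  .seq (drain 0 (pushr 2)) (.seq (pushc 1 none) (drain 2 (.seq (pushr 0) (pushr 1))))

/-- The move to the intermediate stack reverses the word and the copying reverses it back. The
delimiter, pushed in between, ends up below the saved copy. -/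
theorem runs_save : Runs save (mk I [] x.stk R [] [] [])
    (mk I [] x.stk (x.stk ++ none :: R) [] [] []) (7 * x.size + 5) := by
  have h₁ := runs_move02 I [] R [] [] [] x.code
  have h₂ := runs_pushc1 I [] [] R ((x.code.map some).reverse ++ []) [] [] none
  have h₃ := runs_copy I [] (none :: R) [] [] x.code.reverse
  rw [Tr.reverse_stk_reverse, List.map_reverse, List.length_reverse] at h₃
  rw [List.append_nil] at h₂
  rw [List.append_nil] at h₁
  rw [Tr.length_code] at h₁ h₃
  exact (h₁.seq (h₂.seq h₃)).mono (by omega)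

/-- Take back a value from the second stack. -/
def restore : P := .seq (drain 1 (pushr 2)) (drain 2 (pushr 0))

theorem runs_restore : Runs restore (mk I [] [] (x.stk ++ none :: R) [] [] [])
    (mk I [] x.stk R [] [] []) (6 * x.size + 4) := by
  have h₁ := runs_move12 I [] [] [] [] [] R x.code
  have h₂ := runs_move20 I [] [] R [] [] x.code.reverse
  rw [Tr.reverse_stk_reverse, List.map_reverse, List.length_reverse, List.append_nil] at h₂
  rw [List.append_nil] at h₁
  rw [Tr.length_code] at h₁ h₂
  exact (h₁.seq h₂).mono (by omega)

/-- Exchange the current value and the one on the second stack. -/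
def swap : P :=
  .seq (drain 0 (pushr 2)) (.seq (drain 1 (pushr 3))
    (.seq (pushc 1 none) (.seq (drain 2 (pushr 1)) (drain 3 (pushr 0)))))

theorem runs_swap : Runs swap (mk I [] y.stk (x.stk ++ none :: R) [] [] [])
    (mk I [] x.stk (y.stk ++ none :: R) [] [] []) (6 * x.size + 6 * y.size + 9) := by
  have h₁ := runs_move02 I [] (x.stk ++ none :: R) [] [] [] y.code
  have h₂ := runs_move13 I [] [] (y.code.map some).reverse [] [] R x.code
  have h₃ := runs_pushc1 I [] [] R (y.code.map some).reverse (x.code.map some).reverse [] none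
  have h₄ := runs_move21 I [] [] (none :: R) (x.code.map some).reverse [] y.code.reverse
  have h₅ := runs_move30 I [] [] (y.stk ++ none :: R) [] [] x.code.reverse
  rw [Tr.reverse_stk_reverse, List.map_reverse, List.length_reverse] at h₄ h₅
  rw [List.append_nil] at h₁ h₂ h₅
  rw [Tr.length_code] at h₁ h₂ h₄ h₅
  exact (h₁.seq (h₂.seq (h₃.seq (h₄.seq h₅)))).mono (by omega)

/-- Pair the value on the second stack with the current value. -/
def join : P :=
  .seq (drain 1 (pushr 2)) (.seq (drain 2 (pushr 0)) (pushc 0 (some true)))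

theorem runs_join : Runs join (mk I [] y.stk (x.stk ++ none :: R) [] [] [])
    (mk I [] (x.node y).stk R [] [] []) (6 * x.size + 5) := by
  have h₁ := runs_move12 I [] y.stk [] [] [] R x.code
  have h₂ := runs_move20 I [] y.stk R [] [] x.code.reverse
  have h₃ := runs_pushc0 I [] (x.stk ++ y.stk) R [] [] [] (some true)
  rw [Tr.reverse_stk_reverse, List.map_reverse, List.length_reverse] at h₂
  rw [List.append_nil] at h₁
  rw [Tr.length_code] at h₁ h₂
  have : (x.node y).stk = some true :: (x.stk ++ y.stk) := by simp [Tr.stk, Tr.code]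
  rw [this]
  exact (h₁.seq (h₂.seq h₃)).mono (by omega)

end Saving

section Parsing
variable (I : List Symbol) (O : List Bool) (A S T U C : List (Option Bool))

theorem run_popw_four (v : Mem) :
    Run (popw' 4) v (mk I O A S T U C) 1 (v.1, C.head?, v.2.2) (mk I O A S T U C.tail) := by
  have := Run.pop (Γ := Alphabet) (Sum.inr 4) (fun (v : Mem) x => (v.1, x, v.2.2)) v
    (mk I O A S T U C)
  rw [update_four] at this
  exact this

theorem run_pushc_four (v : Mem) (x : Option Bool) :
    Run (pushc 4 x) v (mk I O A S T U C) 1 v (mk I O A S T U (x :: C)) := by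
  have := Run.push (Γ := Alphabet) (Sum.inr 4) (fun _ : Mem => x) v (mk I O A S T U C)
  rw [update_four] at this
  exact this

/-- Is the first register the code of an inner node? -/
def isNode (v : Mem) : Bool := v.1 == some (some true)

/-- Move one symbol from the first to the third stack, and update the number of the subtrees that
are still to be read. -/
def splitStep : P :=
  .seq (popw 0) (.seq (pushr 2)
    (.seq (.ite isNode (.seq (pushc 4 none) (pushc 4 none)) (.load id)) (popw' 4)))

/-- Move the code of one tree from the first to the third stack. -/
def split : P := .seq (.load fun v => (v.1, some none, v.2.2)) (.loop (fun v => v.2.1.isSome) splitStep)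

/-- The second register and the stack `C` count in unary the trees that are still to be read: an
inner node adds two, and every round uses up one. Reading the code of `x` lowers the count by
exactly one, whatever follows. The statement is in continuation form, so that for a node the run on
the second subtree is the continuation of the run on the first. A round takes at most 7 steps. -/
theorem run_splitLoop (x : Tr) : ∀ (A T C : List (Option Bool)) (n : ℕ) (S' : ∀ k, List (Alphabet k)),
    (∀ v : Mem, ∃ m ≤ n, ∃ v', Run (.loop (fun v => v.2.1.isSome) splitStep) (v.1, C.head?, v.2.2)
      (mk I O A S ((x.stk).reverse ++ T) U C.tail) m v' S') →
    ∀ v : Mem, v.2.1.isSome → ∃ m ≤ 7 * x.size + n, ∃ v',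
      Run (.loop (fun v => v.2.1.isSome) splitStep) v (mk I O (x.stk ++ A) S T U C) m v' S' := by
  induction x with
  | leaf =>
    intro A T C n S' h v hv
    obtain ⟨m, hm, v', r⟩ := h (some (some false), v.2)
    refine ⟨_, ?_, v', .loop_step hv (.seq (run_popw0 ..) (.seq (run_pushr_two ..) (.seq
      (.ite_false (by rfl) (.load ..)) (run_popw_four ..)))) r⟩
    simp [Tr.size]; omega
  | node x y hx hy =>
    intro A T C n S' h v hv
    obtain ⟨m, hm, v', r⟩ := hx (y.stk ++ A) (some true :: T) (none :: C) (7 * y.size + n) S'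
      (fun v => by
        refine hy A _ C n S' (fun v => ?_) _ rfl
        obtain ⟨m, hm, v', r⟩ := h v
        refine ⟨m, hm, v', ?_⟩
        simpa [Tr.stk, Tr.code] using r) (some (some true), some none, v.2.2) rfl
    have hstk : (x.node y).stk ++ A = some true :: (x.stk ++ (y.stk ++ A)) := by
      simp [Tr.stk, Tr.code]
    rw [hstk]
    refine ⟨_, ?_, v', .loop_step hv (.seq (run_popw0 ..) (.seq (run_pushr_two ..) (.seq
      (.ite_true (by rfl) (.seq (run_pushc_four ..) (run_pushc_four ..))) (run_popw_four ..)))) r⟩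
    simp [Tr.size]; omega

theorem runs_split (x : Tr) : Runs split (mk I O (x.stk ++ A) S T U [])
    (mk I O A S (x.stk.reverse ++ T) U []) (7 * x.size + 2) := fun v => by
  obtain ⟨m, hm, v', r⟩ := run_splitLoop I O S U x A T [] 1 _
    (fun v => ⟨1, le_rfl, _, .loop_done rfl⟩) (v.1, some none, v.2.2) rfl
  exact ⟨1 + m, by omega, v', .seq (.load ..) r⟩

end Parsing

/-- `Computes p x y n`: with `x` as the current value, `p` replaces `x` by `y` in at most `n`
steps and leaves alone what has been saved. -/
def Computes (p : P) (x y : Tr) (n : ℕ) : Prop :=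
  ∀ I R, Runs p (mk I [] x.stk R [] [] []) (mk I [] y.stk R [] [] []) n

theorem Computes.mono {p x y n m} (h : Computes p x y n) (hnm : n ≤ m) : Computes p x y m :=
  fun I R => (h I R).mono hnm

theorem Computes.seq {p q x y z n m} (hp : Computes p x y n) (hq : Computes q y z m) :
    Computes (.seq p q) x z (n + m) := fun I R => (hp I R).seq (hq I R)

theorem computes_id (x : Tr) : Computes (.load id) x x 1 := fun _ _ _ =>
  ⟨1, le_rfl, _, .load ..⟩

/-- Pair the results of two programs. -/
def pairing (p q : P) : P := .seq save (.seq p (.seq swap (.seq q join)))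

theorem Computes.pairing {p q x y z n m} (hp : Computes p x y n) (hq : Computes q x z m) :
    Computes (pairing p q) x (y.node z) (n + m + (13 * x.size + 12 * y.size + 19)) := fun I R =>
  ((runs_save I R x).seq ((hp I _).seq ((runs_swap I R x y).seq
    ((hq I _).seq (runs_join I R y z))))).mono (by omega)

theorem runs_popw0 (I O x A S T U C) : Runs (popw 0) (mk I O (x :: A) S T U C) (mk I O A S T U C) 1 :=
  fun _ => ⟨1, le_rfl, _, run_popw0 ..⟩

theorem Tr.stk_node (x y : Tr) : (x.node y).stk = some true :: (x.stk ++ y.stk) := by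
  simp [Tr.stk, Tr.code]

/-- The first component of a pair. -/
def fstProg : P :=
  .seq (popw 0) (.seq split (.seq (drain 0 (.load id)) (drain 2 (pushr 0))))

theorem computes_fst (x y : Tr) :
    Computes fstProg (x.node y) x (10 * (x.size + y.size) + 7) := fun I R => by
  have h₁ := runs_popw0 I [] (some true) (x.stk ++ y.stk) R [] [] []
  have h₂ := runs_split I [] y.stk R [] [] x
  have h₃ := runs_clear0 I [] R x.stk.reverse [] [] y.code
  have h₄ := runs_move20 I [] [] R [] [] x.code.reverse
  rw [Tr.reverse_stk_reverse, List.map_reverse, List.length_reverse, List.append_nil] at h₄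
  rw [List.append_nil] at h₂
  rw [Tr.length_code] at h₃ h₄
  rw [Tr.stk_node]
  exact (h₁.seq (h₂.seq (h₃.seq h₄))).mono (by omega)

/-- The second component of a pair. -/
def sndProg : P := .seq (popw 0) (.seq split (drain 2 (.load id)))

theorem computes_snd (x y : Tr) : Computes sndProg (x.node y) y (10 * x.size + 5) := fun I R => by
  have h₁ := runs_popw0 I [] (some true) (x.stk ++ y.stk) R [] [] []
  have h₂ := runs_split I [] y.stk R [] [] x
  have h₃ := runs_clear2 I [] y.stk R [] [] x.code.reverse
  rw [List.map_reverse, List.length_reverse] at h₃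
  rw [List.append_nil] at h₂
  rw [Tr.length_code] at h₃
  rw [Tr.stk_node]
  exact (h₁.seq (h₂.seq h₃)).mono (by omega)

theorem exists_stk_eq (x : Tr) : ∃ b l, x.stk = some b :: List.map some l ∧
    l.length < x.size ∧ (b = true ↔ x ≠ .leaf) := by
  cases x with
  | leaf => exact ⟨false, [], by simp [Tr.stk, Tr.code, Tr.size]⟩
  | node x y => exact ⟨true, x.code ++ y.code, by
      simp [Tr.stk, Tr.code, Tr.size, Tr.length_code]⟩

/-- Discard what is left of the current value, and take back the saved one. -/
def reset : P := .seq (drain 0 (.load id)) restore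

theorem runs_reset (I R) (x : Tr) (l : List Bool) :
    Runs reset (mk I [] (l.map some) (x.stk ++ none :: R) [] [] [])
      (mk I [] x.stk R [] [] []) (3 * l.length + 6 * x.size + 6) :=
  ((runs_clear0 I [] (x.stk ++ none :: R) [] [] [] l).seq (runs_restore I R x)).mono (by omega)

/-- Evaluate a test on the current value, and read the top symbol of the result. -/
def test (c : P) : P := .seq save (.seq c (popw 0))

/-- The first symbol of a prefix code already tells inner nodes from leaves. The rest `l` of the
result stays on the first stack until `reset` clears it, so its length has to be recorded. -/
theorem runs_test {c : P} {x y : Tr} {n : ℕ} (hc : Computes c x y n) (I R v) :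
    ∃ l : List Bool, l.length < y.size ∧ ∃ m ≤ 7 * x.size + n + 6, ∃ v',
      Run (test c) v (mk I [] x.stk R [] [] []) m v'
        (mk I [] (l.map some) (x.stk ++ none :: R) [] [] []) ∧ (isNode v' = true ↔ y ≠ .leaf) := by
  obtain ⟨b, l, hl, hlen, hb⟩ := exists_stk_eq y
  obtain ⟨m₁, hm₁, v₁, r₁⟩ := runs_save I R x v
  obtain ⟨m₂, hm₂, v₂, r₂⟩ := hc I (x.stk ++ none :: R) v₁
  rw [hl] at r₂
  have r₃ := run_popw0 I [] (some b :: l.map some) (x.stk ++ none :: R) [] [] [] v₂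
  refine ⟨l, hlen, m₁ + (m₂ + 1), by omega, _, .seq r₁ (.seq r₂ r₃), ?_⟩
  rw [← hb]
  cases b <;> simp [isNode]

/-- Branch on a test. -/
def branch (c p q : P) : P := .seq (test c) (.ite isNode (.seq reset p) (.seq reset q))

theorem computes_branch {c p q : P} {x y z : Tr} {n m : ℕ} (hc : Computes c x y n)
    (hp : y ≠ .leaf → Computes p x z m) (hq : y = .leaf → Computes q x z m) :
    Computes (branch c p q) x z (n + m + (13 * x.size + 3 * y.size + 13)) := fun I R v => by
  obtain ⟨l, hl, m₁, hm₁, v₁, r₁, hv₁⟩ := runs_test hc I R v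
  obtain ⟨m₂, hm₂, v₂, r₂⟩ := runs_reset I R x l v₁
  by_cases hy : y = .leaf
  · obtain ⟨m₃, hm₃, v₃, r₃⟩ := hq hy I R v₂
    exact ⟨_, by omega, v₃, .seq r₁ (.ite_false (by simpa [hy] using hv₁) (.seq r₂ r₃))⟩
  · obtain ⟨m₃, hm₃, v₃, r₃⟩ := hp hy I R v₂
    exact ⟨_, by omega, v₃, .seq r₁ (.ite_true (hv₁.2 hy) (.seq r₂ r₃))⟩

/-- Repeat `p` as long as the test `c` succeeds. -/
def whileProg (c p : P) : P :=
  .seq (test c) (.seq (.loop isNode (.seq reset (.seq p (test c)))) reset)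

/-- The values `x i` and the test results `y i` are given in advance. A round costs `2 * t` for body
and test, and `16 * B` for clearing the result (3), restoring (6) and saving (7) the value, up to a
constant. -/
theorem computes_while {c p : P} {N t B : ℕ} (x y : ℕ → Tr)
    (hc : ∀ i ≤ N, Computes c (x i) (y i) t) (hp : ∀ i < N, Computes p (x i) (x (i + 1)) t)
    (hx : ∀ i ≤ N, (x i).size ≤ B) (hy : ∀ i ≤ N, (y i).size ≤ B)
    (hlt : ∀ i < N, y i ≠ .leaf) (hN : y N = .leaf) :
    Computes (whileProg c p) (x 0) (x N) ((N + 1) * (2 * t + 16 * B + 20)) := fun I R v => by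
  -- Induction on the number `j` of rounds that remain, from the moment just after a test.
  have key : ∀ j ≤ N, ∀ v, ∀ l : List Bool, l.length < (y (N - j)).size →
      (isNode v = true ↔ y (N - j) ≠ .leaf) → ∃ m ≤ j * (2 * t + 16 * B + 20) + 9 * B + 7, ∃ v',
      Run (.seq (.loop isNode (.seq reset (.seq p (test c)))) reset) v
        (mk I [] (l.map some) ((x (N - j)).stk ++ none :: R) [] [] []) m v'
        (mk I [] (x N).stk R [] [] []) := by
    intro j
    induction j with
    | zero =>
      intro _ v l hl hv
      obtain ⟨m₂, hm₂, v₂, r₂⟩ := runs_reset I R (x N) l v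
      have := hx N le_rfl
      have := hy N le_rfl
      exact ⟨_, by simp at hl; omega, v₂, .seq (.loop_done (by simpa [hN] using hv)) r₂⟩
    | succ j ih =>
      intro hj v l hl hv
      have e : N - j = N - (j + 1) + 1 := by omega
      have hx' := hx (N - (j + 1)) (by omega)
      have hx'' := hx (N - j) (by omega)
      have hy' := hy (N - (j + 1)) (by omega)
      obtain ⟨m₂, hm₂, v₂, r₂⟩ := runs_reset I R (x (N - (j + 1))) l v
      obtain ⟨m₃, hm₃, v₃, r₃⟩ := hp (N - (j + 1)) (by omega) I R v₂
      rw [← e] at r₃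
      obtain ⟨l', hl', m₁, hm₁, v₁, r₁, hv₁⟩ := runs_test (hc (N - j) (by omega)) I R v₃
      obtain ⟨m, hm, v', r⟩ := ih (by omega) v₁ l' hl' hv₁
      cases r with
      | seq rl rr =>
      refine ⟨_, ?_, v', .seq (.loop_step (hv.2 (hlt _ (by omega))) (.seq r₂ (.seq r₃ r₁)) rl) rr⟩
      rw [Nat.succ_mul]
      omega
  obtain ⟨l', hl', m₁, hm₁, v₁, r₁, hv₁⟩ := runs_test (hc 0 (by omega)) I R v
  obtain ⟨m, hm, v', r⟩ := key N le_rfl v₁ l' (by simpa using hl') (by simpa using hv₁)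
  rw [Nat.sub_self] at r
  have := hx 0 (by omega)
  refine ⟨_, ?_, v', .seq r₁ r⟩
  rw [Nat.succ_mul]
  omega

/-- Push a fixed word on the first stack. -/
def pushWord : List Bool → P
  | [] => .load id
  | b :: l => .seq (pushWord l) (pushc 0 (some b))

theorem runs_pushWord (I O A S T U C) (l : List Bool) :
    Runs (pushWord l) (mk I O A S T U C) (mk I O (l.map some ++ A) S T U C) (l.length + 1) := by
  induction l with
  | nil => exact fun _ => ⟨1, le_rfl, _, .load ..⟩
  | cons b l ih => exact (ih.seq (runs_pushc0 I O _ S T U C (some b))).mono (by simp)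

/-- Replace the current value by a fixed one. -/
def constProg (y : Tr) : P := .seq (drain 0 (.load id)) (pushWord y.code)

theorem computes_const (x y : Tr) : Computes (constProg y) x y (3 * x.size + y.size + 3) :=
  fun I R => by
  have h₁ := runs_clear0 I [] R [] [] [] x.code
  have h₂ := runs_pushWord I [] [] R [] [] [] y.code
  rw [List.append_nil] at h₂
  rw [Tr.length_code] at h₁ h₂
  exact (h₁.seq h₂).mono (by omega)

/-- Pop the third and the fourth stack into the two registers. -/
def popBoth : P := .seq (popw 2) (popw' 3)

/-- Compare the words on the third and the fourth stack. -/
def compareWords : P :=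
  .seq (.load fun v => (v.1, v.2.1, v.2.2.1, true)) (.seq popBoth
    (.loop (fun v => v.1.isSome || v.2.1.isSome)
      (.seq (.load fun v => (v.1, v.2.1, v.2.2.1, v.2.2.2 && v.1 == v.2.1)) popBoth)))

theorem run_popBoth (I O A S T U C) (v : Mem) : Run popBoth v (mk I O A S T U C) 2
    (T.head?, U.head?, v.2.2) (mk I O A S T.tail U.tail C) := by
  have h₁ := Run.pop (Γ := Alphabet) (Sum.inr 2) (fun (v : Mem) x => (x, v.2)) v
    (mk I O A S T U C)
  rw [update_two] at h₁
  have h₂ := Run.pop (Γ := Alphabet) (Sum.inr 3) (fun (v : Mem) x => (v.1, x, v.2.2))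
    (T.head?, v.2) (mk I O A S T.tail U C)
  rw [update_three] at h₂
  exact .seq h₁ h₂

theorem run_compareWords (I O A S C) (T U : List (Option Bool)) (v : Mem) :
    ∃ m ≤ 4 * (T.length + U.length) + 4, ∃ v' : Mem, v'.2.2.2 = decide (T = U) ∧
      Run compareWords v (mk I O A S T U C) m v' (mk I O A S [] [] C) := by
  -- The heads of `T` and `U` are already in the registers, and `f` tells whether all earlier pairs
  -- agreed. The induction is on the total length because one word may run out before the other.
  have key : ∀ (k : ℕ) (T U : List (Option Bool)) (y : Option Symbol) (f : Bool),
      T.length + U.length = k →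
      ∃ m ≤ 4 * k + 1, ∃ v' : Mem, v'.2.2.2 = (f && decide (T = U)) ∧
      Run (.loop (fun v => v.1.isSome || v.2.1.isSome)
      (.seq (.load fun v => (v.1, v.2.1, v.2.2.1, v.2.2.2 && v.1 == v.2.1)) popBoth))
        (T.head?, U.head?, y, f) (mk I O A S T.tail U.tail C) m v' (mk I O A S [] [] C) := by
    intro k
    induction k using Nat.strong_induction_on with
    | _ k ih =>
    intro T U y f hk
    by_cases hTU : T = [] ∧ U = []
    · obtain ⟨rfl, rfl⟩ := hTU
      exact ⟨1, by omega, _, by simp, .loop_done rfl⟩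
    · have hlen : T.tail.length + U.tail.length < k := by
        rcases T with _ | ⟨a, T⟩ <;> rcases U with _ | ⟨b, U⟩ <;> simp at hTU hk ⊢ <;> omega
      obtain ⟨m, hm, v', hv', r⟩ := ih _ hlen T.tail U.tail y (f && T.head? == U.head?) rfl
      refine ⟨_, ?_, v', ?_, .loop_step ?_ (.seq (.load ..) (run_popBoth ..)) r⟩
      · omega
      · rw [hv']
        rcases T with _ | ⟨a, T⟩ <;> rcases U with _ | ⟨b, U⟩ <;> simp
        · rw [Bool.and_assoc]
          congr 1
          by_cases h : a = b <;> by_cases h' : T = U <;> simp [h, h']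
      · rcases T with _ | ⟨a, T⟩ <;> rcases U with _ | ⟨b, U⟩ <;> simp at hTU ⊢
  obtain ⟨m, hm, v', hv', r⟩ := key _ T U v.2.2.1 true rfl
  exact ⟨_, by omega, v', by simpa using hv', .seq (.load ..) (.seq (run_popBoth ..) r)⟩

/-- Are the components of a pair equal? -/
def eqProg : P :=
  .seq (popw 0) (.seq split (.seq (drain 0 (pushr 3)) (.seq compareWords
    (.ite (fun v => v.2.2.2) (pushWord (Tr.ofBool true).code) (pushWord (Tr.ofBool false).code)))))

theorem computes_eq (x y : Tr) :
    Computes eqProg (x.node y) (Tr.ofBool (decide (x = y))) (11 * (x.size + y.size) + 14) := by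
  intro I R v
  have h₁ := runs_popw0 I [] (some true) (x.stk ++ y.stk) R [] [] []
  have h₂ := runs_split I [] y.stk R [] [] x
  have h₃ := runs_move03 I [] R x.stk.reverse [] [] y.code
  rw [List.append_nil] at h₂ h₃
  rw [Tr.length_code] at h₃
  obtain ⟨m₁, hm₁, v₁, r₁⟩ := h₁ v
  obtain ⟨m₂, hm₂, v₂, r₂⟩ := h₂ v₁
  obtain ⟨m₃, hm₃, v₃, r₃⟩ := h₃ v₂
  obtain ⟨m₄, hm₄, v₄, hv₄, r₄⟩ := run_compareWords I [] [] R [] x.stk.reverse y.stk.reverse v₃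
  have hxy : (x.stk.reverse = y.stk.reverse) ↔ x = y := by
    rw [List.reverse_inj]
    refine ⟨fun h => Tr.code_injective ?_, fun h => h ▸ rfl⟩
    exact List.map_injective_iff.2 (Option.some_injective _) h
  simp only [hxy] at hv₄
  have hlen : ∀ z : Tr, z.stk.reverse.length = z.size := by simp [Tr.stk, Tr.length_code]
  rw [hlen, hlen] at hm₄
  have h₅ := fun b => runs_pushWord I [] [] R [] [] [] (Tr.ofBool b).code v₄
  have hb : ∀ b, (Tr.ofBool b).code.length ≤ 3 := fun b => by
    rw [Tr.length_code]; exact Tr.size_ofBool b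
  simp only [List.append_nil] at h₅
  rw [Tr.stk_node]
  by_cases h : x = y
  · obtain ⟨m₅, hm₅, v₅, r₅⟩ := h₅ true
    have := hb true
    refine ⟨m₁ + (m₂ + (m₃ + (m₄ + (m₅ + 1)))), ?_, v₅,
      .seq r₁ (.seq r₂ (.seq r₃ (.seq r₄ (.ite_true ?_ ?_))))⟩
    · omega
    · simp [hv₄, h]
    · simpa [h, Tr.stk] using r₅
  · obtain ⟨m₅, hm₅, v₅, r₅⟩ := h₅ false
    have := hb false
    refine ⟨m₁ + (m₂ + (m₃ + (m₄ + (m₅ + 1)))), ?_, v₅,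
      .seq r₁ (.seq r₂ (.seq r₃ (.seq r₄ (.ite_false ?_ ?_))))⟩
    · omega
    · simp [hv₄, h]
    · simpa [h, Tr.stk] using r₅

end StackProg

/-! ### Encodings and the calculus of polynomial-time functions -/

namespace StackProg

open Turing Function NestSetSAT

/-- Types whose elements are represented by trees. -/
class Enc (α : Type) where
  /-- the representation -/
  enc : α → Tr
  /-- different elements are represented by different trees -/
  inj : Injective enc

open Enc (enc)

/-- The size of the representation. -/
def sz {α : Type} [Enc α] (a : α) : ℕ := (enc a).size

instance : Enc Unit := ⟨fun _ => .leaf, fun _ _ _ => rfl⟩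

instance : Enc Bool := ⟨Tr.ofBool, fun a b h => by cases a <;> cases b <;> simp [Tr.ofBool] at h ⊢⟩

section
variable {α β γ δ : Type}

/-- Case distinction on a list. -/
def caseList (l : List β) (f : γ) (g : β → List β → γ) : γ :=
  match l with
  | [] => f
  | b :: l => g b l

@[simp] theorem caseList_nil (f : γ) (g : β → List β → γ) : caseList [] f g = f := rfl

@[simp] theorem caseList_cons (b : β) (l : List β) (f : γ) (g : β → List β → γ) :
    caseList (b :: l) f g = g b l := rfl

section Types

variable [Enc α] [Enc β] [Enc γ] [Enc δ]

instance : Enc (α × β) := ⟨fun p => .node (enc p.1) (enc p.2), fun p q h => by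
  simp only [Tr.node.injEq] at h
  exact Prod.ext (Enc.inj h.1) (Enc.inj h.2)⟩

/-- The tree that represents a list. -/
def encList : List α → Tr
  | [] => .leaf
  | a :: l => .node (enc a) (encList l)

/-- A non-empty list has the same tree as the pair of its head and its tail. `PT.cons`,
`PT.caseList` and `PT.foldl` use this to change types at no cost. -/
instance : Enc (List α) := ⟨encList, fun l => by
  induction l with
  | nil => intro l h; cases l <;> simp [encList] at h ⊢
  | cons a l ih =>
    intro l' h
    cases l' with
    | nil => simp [encList] at h
    | cons b l' =>
      simp only [encList, Tr.node.injEq] at h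
      rw [Enc.inj h.1, ih h.2]⟩

theorem bits_injective : Injective Nat.bits := by
  have : ∀ n : ℕ, n.bits.foldr Nat.bit 0 = n := fun n => by
    induction n using Nat.binaryRec' with
    | zero => simp
    | bit b n h ih => rw [Nat.bits_append_bit _ _ h, List.foldr_cons, ih]
  intro m n h
  rw [← this m, h, this n]

/-- A number and the list of its binary digits have the same tree, so the digit lists found by the
parser already represent the variables (`enc_toBits`). -/
instance : Enc ℕ := ⟨fun n => enc n.bits, fun _ _ h => bits_injective (Enc.inj h)⟩

theorem sz_pos (a : α) : 0 < sz a := Tr.size_pos _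

@[simp] theorem sz_pair (p : α × β) : sz p = sz p.1 + sz p.2 + 1 := rfl

@[simp] theorem sz_nil : sz ([] : List α) = 1 := rfl

@[simp] theorem sz_cons (a : α) (l : List α) : sz (a :: l) = sz a + sz l + 1 := rfl

theorem sz_bool (b : Bool) : sz b ≤ 3 := Tr.size_ofBool b

theorem sz_append (l l' : List α) : sz (l ++ l') + 1 = sz l + sz l' := by
  induction l with
  | nil => simp [Nat.add_comm]
  | cons a l ih => simp; omega

theorem sz_take_le (l : List α) (n : ℕ) : sz (l.take n) ≤ sz l := by
  have := sz_append (l.take n) (l.drop n)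
  rw [List.take_append_drop] at this
  have := sz_pos (l.drop n)
  omega

theorem sz_drop_le (l : List α) (n : ℕ) : sz (l.drop n) ≤ sz l := by
  have := sz_append (l.take n) (l.drop n)
  rw [List.take_append_drop] at this
  have := sz_pos (l.take n)
  omega

theorem sz_reverse (l : List α) : sz l.reverse = sz l := by
  induction l with
  | nil => rfl
  | cons a l ih =>
    have := sz_append l.reverse [a]
    simp at this ⊢
    omega

theorem sz_lt_of_mem {a : α} {l : List α} (h : a ∈ l) : sz a < sz l := by
  induction l with
  | nil => simp at h
  | cons b l ih =>
    rcases List.mem_cons.1 h with rfl | h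
    · rw [sz_cons]; omega
    · have := ih h
      simp; omega

theorem length_lt_sz (l : List α) : l.length < sz l := by
  induction l with
  | nil => simp
  | cons b l ih => simp; omega

theorem sz_list_le {l : List α} {B : ℕ} (h : ∀ a ∈ l, sz a ≤ B) : sz l ≤ l.length * (B + 1) + 1 := by
  induction l with
  | nil => simp
  | cons a l ih =>
    have := ih fun b hb => h b (List.mem_cons_of_mem _ hb)
    have := h a List.mem_cons_self
    simp [Nat.add_mul]; omega

/-- The function `b` is bounded by a polynomial in `m`. -/
def PolyIn {ι : Type} (m b : ι → ℕ) : Prop := ∃ d, ∀ a, b a ≤ (m a + 2) ^ d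

/-- The function `b` is bounded by a polynomial in the size of the representation. -/
abbrev PolyBdd {α : Type} [Enc α] (b : α → ℕ) : Prop := PolyIn sz b

namespace PolyIn

variable {ι : Type} {m b b' : ι → ℕ}

theorem mono (h : PolyIn m b) (hb : ∀ a, b' a ≤ b a) : PolyIn m b' :=
  let ⟨d, hd⟩ := h
  ⟨d, fun a => (hb a).trans (hd a)⟩

theorem const (n : ℕ) : PolyIn m fun _ => n :=
  ⟨n, fun _ => (Nat.lt_two_pow_self).le.trans (Nat.pow_le_pow_left (by omega) _)⟩

theorem self : PolyIn m fun a => m a := ⟨1, fun a => by simp⟩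

theorem mul (h : PolyIn m b) (h' : PolyIn m b') : PolyIn m fun a => b a * b' a := by
  obtain ⟨d, hd⟩ := h
  obtain ⟨d', hd'⟩ := h'
  exact ⟨d + d', fun a => by rw [pow_add]; exact Nat.mul_le_mul (hd a) (hd' a)⟩

theorem add (h : PolyIn m b) (h' : PolyIn m b') : PolyIn m fun a => b a + b' a := by
  obtain ⟨d, hd⟩ := h
  obtain ⟨d', hd'⟩ := h'
  refine ⟨d + d' + 1, fun a => ?_⟩
  have h1 : (m a + 2) ^ d ≤ (m a + 2) ^ (d + d') := Nat.pow_le_pow_right (by omega) (by omega)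
  have h2 : (m a + 2) ^ d' ≤ (m a + 2) ^ (d + d') := Nat.pow_le_pow_right (by omega) (by omega)
  calc b a + b' a ≤ (m a + 2) ^ (d + d') * 2 := by have := hd a; have := hd' a; omega
    _ ≤ _ := by rw [pow_succ]; exact Nat.mul_le_mul_left _ (by omega)

theorem pow (h : PolyIn m b) (n : ℕ) : PolyIn m fun a => b a ^ n := by
  obtain ⟨d, hd⟩ := h
  exact ⟨d * n, fun a => by rw [pow_mul]; exact Nat.pow_le_pow_left (hd a) _⟩

theorem comp {β : Type} [Enc β] {b : β → ℕ} (h : PolyBdd b) {f : ι → β}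
    (hf : PolyIn m fun a => sz (f a)) : PolyIn m fun a => b (f a) := by
  obtain ⟨d, hd⟩ := h
  exact ((hf.add (const 2)).pow d).mono fun a => hd _

end PolyIn

/-- The function `f` is computed by a program in polynomial time. -/
def PT (f : α → β) : Prop :=
  PolyBdd (fun a => sz (f a)) ∧
    ∃ (p : P) (b : α → ℕ), PolyBdd b ∧ ∀ a, Computes p (enc a) (enc (f a)) (b a)

namespace PT

theorem id : PT fun a : α => a :=
  ⟨.self, _, _, .const 1, fun _ => computes_id _⟩

/-- The running time of the second program is measured in the size of `f a`; for this reason `PT`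
includes a bound on the size of the result. -/
theorem comp {g : β → γ} {f : α → β} (hg : PT g) (hf : PT f) : PT fun a => g (f a) := by
  obtain ⟨sf, p, b, hb, hp⟩ := hf
  obtain ⟨sg, q, c, hc, hq⟩ := hg
  exact ⟨sg.comp sf, _, _, hb.add (hc.comp sf), fun a => (hp a).seq (hq _)⟩

theorem const (c : β) : PT fun _ : α => c :=
  ⟨.const (sz c), _, _, (((PolyIn.const 3).mul .self).add (.const (sz c))).add (.const 3),
    fun _ => computes_const _ _⟩

theorem pair {f : α → β} {g : α → γ} (hf : PT f) (hg : PT g) : PT fun a => (f a, g a) := by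
  obtain ⟨sf, p, b, hb, hp⟩ := hf
  obtain ⟨sg, q, c, hc, hq⟩ := hg
  exact ⟨(sf.add sg).add (.const 1), _, _,
    (hb.add hc).add ((((PolyIn.const 13).mul .self).add ((PolyIn.const 12).mul sf)).add
      (.const 19)), fun a => (hp a).pairing (hq a)⟩

theorem cons {f : α → β} {g : α → List β} (hf : PT f) (hg : PT g) : PT fun a => f a :: g a :=
  pair hf hg

theorem fst {f : α → β × γ} (hf : PT f) : PT fun a => (f a).1 :=
  comp (g := Prod.fst) ⟨PolyIn.self.mono fun p => by simp; omega, _, _,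
    ((PolyIn.const 10).mul .self).add (.const 7), fun p =>
    (computes_fst _ _).mono (by have := sz_pair p; simp only [sz] at *; omega)⟩ hf

theorem snd {f : α → β × γ} (hf : PT f) : PT fun a => (f a).2 :=
  comp (g := Prod.snd) ⟨PolyIn.self.mono fun p => by simp; omega, _, _,
    ((PolyIn.const 10).mul .self).add (.const 5), fun p =>
    (computes_snd _ _).mono (by have := sz_pair p; simp only [sz] at *; omega)⟩ hf

theorem eq [DecidableEq β] {f g : α → β} (hf : PT f) (hg : PT g) :
    PT fun a => decide (f a = g a) :=
  comp (g := fun p : β × β => decide (p.1 = p.2))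
    ⟨(PolyIn.const 3).mono fun p => sz_bool _, _, _,
    ((PolyIn.const 11).mul .self).add (.const 14), fun p => by
      have := computes_eq (enc p.1) (enc p.2)
      simp only [Enc.inj.eq_iff] at this
      exact this.mono (by have := sz_pair p; simp only [sz] at *; omega)⟩ (pair hf hg)

theorem cond {c : α → Bool} {f g : α → β} (hc : PT c) (hf : PT f) (hg : PT g) :
    PT fun a => bif c a then f a else g a := by
  obtain ⟨-, r, k, hk, hr⟩ := hc
  obtain ⟨sf, p, b, hb, hp⟩ := hf
  obtain ⟨sg, q, d, hd, hq⟩ := hg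
  refine ⟨(sf.add sg).mono fun a => ?_, branch r p q, _,
    (hk.add (hb.add hd)).add (((PolyIn.const 13).mul .self).add (.const 22)), fun a => ?_⟩
  · dsimp only
    cases c a with
    | false => exact le_add_self
    | true => exact le_self_add
  refine (computes_branch (z := enc (bif c a then f a else g a)) (m := b a + d a) (hr a)
    (fun h => ?_) (fun h => ?_)).mono ?_
  · cases hca : c a with
    | false => exact absurd (by rw [hca]; rfl) h
    | true => exact (hp a).mono (by omega)
  · cases hca : c a with
    | false => exact (hq a).mono (by omega)
    | true => rw [hca] at h; exact absurd h (by simp [enc, Tr.ofBool])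
  · have := sz_bool (c a)
    simp only [sz] at *
    omega

end PT

namespace PT

theorem caseList {l : α → List β} {f : α → γ} {g : α → β → List β → γ} (hl : PT l) (hf : PT f)
    (hg : PT fun p : α × β × List β => g p.1 p.2.1 p.2.2) :
    PT fun a => caseList (l a) (f a) (g a) := by
  obtain ⟨sl, r, k, hk, hr⟩ := hl
  obtain ⟨sf, p, b, hb, hp⟩ := hf
  obtain ⟨⟨e, he⟩, q, d, ⟨e', he'⟩, hq⟩ := hg
  -- If `l a = y :: t`, this is exactly `sz (a, y, t) + 2`, and it also makes sense when `l a` is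
  -- empty.
  have hs : PolyBdd fun a => sz a + sz (l a) + 3 := (PolyIn.self.add sl).add (.const 3)
  obtain ⟨-, r', k', hk', hr'⟩ := (PT.id (α := α)).pair ⟨sl, r, k, hk, hr⟩
  refine ⟨(sf.add (hs.pow e)).mono fun a => ?_, branch r (.seq r' q) p, _,
    (hk.add (hb.add (hk'.add (hs.pow e')))).add
      (((PolyIn.const 13).mul .self).add (((PolyIn.const 3).mul sl).add (.const 13))),
    fun a => ?_⟩
  · dsimp only
    cases h : l a with
    | nil => simp
    | cons y t =>
      have := he (a, y, t)
      simp only [sz_pair, sz_cons, caseList_cons] at *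
      refine this.trans (le_add_left ?_)
      exact Nat.pow_le_pow_left (by omega) _
  · refine (computes_branch (z := enc (StackProg.caseList (l a) (f a) (g a)))
      (m := b a + (k' a + (sz a + sz (l a) + 3) ^ e')) (hr a)
      (fun h => ?_) (fun h => ?_)).mono (by simp only [sz]; omega)
    · have h₁ := hr' a
      cases hla : l a with
      | nil => exact absurd (by rw [hla]; rfl) h
      | cons y t =>
        simp only [hla] at h₁
        have h₂ := he' (a, y, t)
        have : (sz (a, y, t) + 2) ^ e' ≤ (sz a + sz (y :: t) + 3) ^ e' :=
          Nat.pow_le_pow_left (by simp only [sz_pair, sz_cons]; omega) _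
        -- The tree of `(a, y :: t)` is that of `(a, y, t)`.
        exact (h₁.seq (hq (a, y, t))).mono (by omega)
    · cases hla : l a with
      | nil => exact (hp a).mono (by omega)
      | cons y t =>
        rw [hla] at h
        exact absurd h (by simp [enc, encList])

/-- Iterating a polynomial-time function may let the accumulator grow exponentially, so `hsz` asks
for a polynomial bound on all partial folds. The loop works on the parameter, the accumulator and
the rest of the list, until that rest is a leaf. -/
theorem foldl {l : α → List β} {init : α → δ} {g : α → δ → β → δ} (hl : PT l) (hi : PT init)
    (hg : PT fun p : α × δ × β => g p.1 p.2.1 p.2.2) {bd : α → ℕ} (hbd : PolyBdd bd)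
    (hsz : ∀ a n, sz (((l a).take n).foldl (g a) (init a)) ≤ bd a) :
    PT fun a => (l a).foldl (g a) (init a) := by
  -- The loop body is only run on a non-empty rest, whose tree is that of an element of `β × List
  -- β`; head and tail are then projections.
  have hstep : PT fun q : α × δ × β × List β => (q.1, g q.1 q.2.1 q.2.2.1, q.2.2.2) :=
    pair (fst id) (pair (comp hg (pair (fst id) (pair (fst (snd id)) (fst (snd (snd id))))))
      (snd (snd (snd id))))
  have htest : PT fun q : α × δ × List β => q.2.2 := snd (snd id)
  have hout : PT fun q : α × δ × List β => q.2.1 := fst (snd id)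
  obtain ⟨-, p₁, b₁, hb₁, hp₁⟩ := pair id (pair hi hl)
  obtain ⟨-, p₂, b₂, ⟨d₂, hb₂⟩, hp₂⟩ := hstep
  obtain ⟨-, p₃, b₃, ⟨d₃, hb₃⟩, hp₃⟩ := htest
  obtain ⟨-, p₄, b₄, ⟨d₄, hb₄⟩, hp₄⟩ := hout
  have hB : PolyBdd fun a => sz a + bd a + sz (l a) + 2 :=
    ((PolyIn.self.add hbd).add hl.1).add (.const 2)
  have hB' := hB.add (.const 2)
  refine ⟨hbd.mono fun a => by simpa using hsz a (l a).length,
    .seq p₁ (.seq (whileProg p₃ p₂) p₄), _,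
    hb₁.add (((hl.1.add (.const 1)).mul
      ((((PolyIn.const 2).mul ((hB'.pow d₂).add (hB'.pow d₃)))).add
        (((PolyIn.const 16).mul hB).add (.const 20)))).add
      (hB'.pow d₄)), fun a => ?_⟩
  let st : ℕ → α × δ × List β := fun i => (a, ((l a).take i).foldl (g a) (init a), (l a).drop i)
  let B := sz a + bd a + sz (l a) + 2
  have hst : ∀ i, sz (st i) ≤ B := fun i => by
    have := hsz a i
    have := sz_drop_le (l a) i
    simp only [st, sz_pair, B]; omega
  have hloop := computes_while (c := p₃) (p := p₂) (N := (l a).length)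
    (t := (B + 2) ^ d₂ + (B + 2) ^ d₃) (B := B)
    (fun i => enc (st i)) (fun i => enc ((l a).drop i))
    (fun i _ => (hp₃ (st i)).mono ((hb₃ _).trans
      (le_add_left (Nat.pow_le_pow_left (by have := hst i; omega) _))))
    (fun i hi => by
      have h := hp₂ (a, ((l a).take i).foldl (g a) (init a), (l a)[i], (l a).drop (i + 1))
      have e₁ : enc (a, ((l a).take i).foldl (g a) (init a), (l a)[i], (l a).drop (i + 1)) =
          enc (st i) := by
        simp only [st]
        rw [List.drop_eq_getElem_cons hi]
        rfl
      have e₂ : sz (a, ((l a).take i).foldl (g a) (init a), (l a)[i], (l a).drop (i + 1)) =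
          sz (st i) := congrArg Tr.size e₁
      rw [e₁] at h
      have e₃ : (a, g a (((l a).take i).foldl (g a) (init a)) (l a)[i], (l a).drop (i + 1)) =
          st (i + 1) := by
        simp only [st]
        rw [List.take_add_one, List.getElem?_eq_getElem hi, List.foldl_append]
        rfl
      simp only [e₃] at h
      refine h.mono ((hb₂ _).trans (le_add_right ?_))
      rw [e₂]
      exact Nat.pow_le_pow_left (by have := hst i; omega) _)
    (fun i _ => hst i)
    (fun i _ => (sz_drop_le (l a) i).trans (by omega))
    (fun i hi => by
      rw [List.drop_eq_getElem_cons hi]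
      simp [enc, encList])
    (by simp [enc, encList])
  have h₀ : st 0 = (a, init a, l a) := by simp [st]
  have hN : (st (l a).length).2.1 = (l a).foldl (g a) (init a) := by simp [st]
  rw [h₀] at hloop
  have hlast := hp₄ (st (l a).length)
  simp only [hN] at hlast
  refine ((hp₁ a).seq (hloop.seq (hlast.mono ((hb₄ _).trans
    (Nat.pow_le_pow_left (Nat.add_le_add_right (hst _) 2) _))))).mono ?_
  have := length_lt_sz (l a)
  simp only [B]
  exact Nat.add_le_add_left (Nat.add_le_add_right (Nat.mul_le_mul (by omega) (by omega)) _) _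

theorem of_eq {f g : α → β} (h : PT f) (e : ∀ a, f a = g a) : PT g := funext e ▸ h

theorem not {c : α → Bool} (hc : PT c) : PT fun a => !c a :=
  (cond hc (const false) (const true)).of_eq fun a => by cases c a <;> rfl

theorem and {c d : α → Bool} (hc : PT c) (hd : PT d) : PT fun a => c a && d a :=
  (cond hc hd (const false)).of_eq fun a => by cases c a <;> rfl

theorem isEmpty {l : α → List β} (hl : PT l) : PT fun a => (l a).isEmpty :=
  (caseList hl (const true) (const false)).of_eq fun a => by cases l a <;> rfl

theorem reverse {l : α → List β} (hl : PT l) : PT fun a => (l a).reverse := by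
  have e : ∀ l : List β, l.foldl (fun acc y => y :: acc) [] = l.reverse := fun l => by simp
  refine (foldl (g := fun _ acc y => y :: acc) hl (const []) (cons (snd (snd id)) (fst (snd id)))
    hl.1 fun a n => ?_).of_eq fun a => e _
  rw [e, sz_reverse]
  exact sz_take_le _ _

theorem append {l m : α → List β} (hl : PT l) (hm : PT m) : PT fun a => l a ++ m a := by
  have e : ∀ l m : List β, l.foldl (fun acc y => y :: acc) m = l.reverse ++ m := fun l m => by simp
  refine (foldl (g := fun _ acc y => y :: acc) hl.reverse hm (cons (snd (snd id)) (fst (snd id)))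
    (hl.1.add hm.1) fun a n => ?_).of_eq fun a => by rw [e, List.reverse_reverse]
  rw [e]
  have h₁ := sz_append ((l a).reverse.take n).reverse (m a)
  have h₂ := sz_take_le (l a).reverse n
  rw [sz_reverse] at h₁ h₂
  omega

theorem flatMap {l : α → List β} {g : α → β → List γ} (hl : PT l)
    (hg : PT fun p : α × β => g p.1 p.2) : PT fun a => (l a).flatMap (g a) := by
  have e : ∀ (l : List β) (g : β → List γ), l.foldl (fun acc y => acc ++ g y) [] = l.flatMap g :=
    fun l g => by rw [List.flatMap_eq_foldl]
  obtain ⟨d, hd⟩ := hg.1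
  have hB : PolyBdd fun a => sz (l a) * ((sz a + sz (l a) + 3) ^ d + 1) + 1 :=
    (hl.1.mul ((((PolyIn.self.add hl.1).add (.const 3)).pow d).add (.const 1))).add (.const 1)
  refine (foldl (g := fun a acc y => acc ++ g a y) hl (const [])
    (append (fst (snd id)) (comp hg (pair (fst id) (snd (snd id))))) hB fun a n => ?_).of_eq
    fun a => e _ _
  rw [e]
  -- Each piece `g a y` is polynomially small in `a` and `l a`. Only membership in `l a` matters, so
  -- the induction runs over arbitrary lists `t` instead of prefixes.
  have key : ∀ t : List β, (∀ y ∈ t, y ∈ l a) →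
      sz (t.flatMap (g a)) ≤ t.length * ((sz a + sz (l a) + 3) ^ d + 1) + 1 := by
    intro t
    induction t with
    | nil => simp
    | cons y t ih =>
      intro ht
      have h₁ := ih fun z hz => ht z (List.mem_cons_of_mem _ hz)
      have h₂ := sz_append (g a y) (t.flatMap (g a))
      have h₃ := hd (a, y)
      have h₄ := sz_lt_of_mem (ht y List.mem_cons_self)
      have h₅ : (sz (a, y) + 2) ^ d ≤ (sz a + sz (l a) + 3) ^ d :=
        Nat.pow_le_pow_left (by simp; omega) _
      simp only [List.flatMap_cons, List.length_cons, Nat.succ_mul] at *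
      omega
  refine (key _ fun y hy => List.mem_of_mem_take hy).trans ?_
  have h₁ := length_lt_sz (l a)
  have h₂ := List.length_take_le n (l a)
  gcongr
  exact (List.length_take_le' n (l a)).trans h₁.le

theorem map {l : α → List β} {g : α → β → γ} (hl : PT l) (hg : PT fun p : α × β => g p.1 p.2) :
    PT fun a => (l a).map (g a) :=
  (flatMap (g := fun a y => [g a y]) hl (cons hg (const []))).of_eq fun a => by
    rw [List.map_eq_flatMap]

theorem filter {l : α → List β} {g : α → β → Bool} (hl : PT l)
    (hg : PT fun p : α × β => g p.1 p.2) : PT fun a => (l a).filter (g a) :=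
  (flatMap (g := fun a y => bif g a y then [y] else []) hl
    (cond hg (cons (snd id) (const [])) (const []))).of_eq fun a => by
      induction l a with
      | nil => rfl
      | cons y t ih => simp only [List.flatMap_cons, List.filter_cons, ih]; cases g a y <;> simp

theorem all {l : α → List β} {g : α → β → Bool} (hl : PT l)
    (hg : PT fun p : α × β => g p.1 p.2) : PT fun a => (l a).all (g a) :=
  (isEmpty (filter (g := fun a y => !g a y) hl (not hg))).of_eq fun a => by
    induction l a with
    | nil => rfl
    | cons y t ih => simp only [List.filter_cons, List.all_cons, ← ih]; cases g a y <;> simp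

theorem any {l : α → List β} {g : α → β → Bool} (hl : PT l)
    (hg : PT fun p : α × β => g p.1 p.2) : PT fun a => (l a).any (g a) :=
  (not (all (g := fun a y => !g a y) hl (not hg))).of_eq fun a => by
    rw [List.not_all_eq_any_not]; simp only [Bool.not_not]

theorem mem [DecidableEq β] {x : α → β} {l : α → List β} {inst : ∀ a, Decidable (x a ∈ l a)}
    (hx : PT x) (hl : PT l) : PT fun a => decide (x a ∈ l a) :=
  (any (g := fun a y => decide (y = x a)) hl (eq (snd id) (comp hx (fst id)))).of_eq fun a => by
    rw [Bool.eq_iff_iff, List.any_eq_true]; simp only [decide_eq_true_eq, exists_eq_right]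

end PT
end Types
end
end StackProg

/-! ### The algorithm, and why one step takes polynomial time -/

namespace StackProg

open NestSetSAT
open Enc (enc)

/-- A set of variables that may grow to a nest-set: the number of vertices that may still be used,
the set, and all clauses that contain exactly one literal of each of its variables. -/
abbrev Cand : Type := List Unit × List ℕ × List Clause

/-- The formula that is left, the size of the nest-sets that are searched for, and the candidates
that have not been examined. -/
abbrev State : Type := CNF × List Unit × List Cand

/-- The clause `C` has a variable in `s`. -/
def touches (C : Clause) (s : List ℕ) : Bool := C.any fun l => decide (l.1 ∈ s)

/-- The variable `x` is neither in `C` nor in `s`. -/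
def avoids (x : ℕ) (C : Clause) (s : List ℕ) : Bool :=
  (C.all fun l => !decide (l.1 = x)) && !decide (x ∈ s)

/-- The pairs of variables that show that `s` is not a nest-set. -/
def conflicts (F : CNF) (s : List ℕ) : List (ℕ × ℕ) :=
  F.flatMap fun C => F.flatMap fun C' =>
    bif touches C s && touches C' s then
      C.flatMap fun l => C'.flatMap fun l' =>
        bif avoids l.1 C' s && avoids l'.1 C s then [(l.1, l'.1)] else []
    else []

/-- The elimination of the variables in `s` from `F`. Here `A` consists of all clauses that contain
exactly one literal of each variable in `s`. -/
def elim (F : CNF) (s : List ℕ) (A : List Clause) : CNF :=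
  (F.map fun C => C.filter fun l => !decide (l.1 ∈ s)).filter fun D =>
    A.all fun a => F.any fun C => C.all fun l => decide (l ∈ a ++ D)

/-- Add a variable to a candidate. -/
def extend (x : ℕ) (c : Cand) : Cand :=
  (caseList c.1 [] fun _ t => t, x :: c.2.1,
    c.2.2.flatMap fun a => [(x, true) :: a, (x, false) :: a])

/-- All candidates with one element. -/
def singletons (F : CNF) (k : List Unit) : List Cand :=
  F.flatMap fun C => C.map fun l => extend l.1 (() :: k, [], [[]])

/-- One step of the algorithm: examine the next candidate. -/
def step (q : State) : State :=
  caseList q.2.2 (q.1, () :: q.2.1, singletons q.1 (() :: q.2.1)) fun c w =>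
    caseList c.1 (q.1, q.2.1, w) fun _ _ =>
      caseList (conflicts q.1 c.2.1) (elim q.1 c.2.1 c.2.2, [], []) fun p _ =>
        (q.1, q.2.1, extend p.1 c :: extend p.2 c :: w)

/-- Has the formula a variable? -/
def hasVar (F : CNF) : Bool := F.any fun C => !C.isEmpty

/-- A formula whose variables are given by their binary digits. -/
abbrev BitCNF : Type := List (List (List Bool × Bool))

/-- The symbols of the input, as values of the computation. -/
def symbolValue : Symbol → List (Bool × Bool)
  | .clauseEnd => []
  | .positive => [(false, true)]
  | .negative => [(false, false)]
  | .bit b => [(true, b)]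

/-- Add a symbol in front of a partially read formula. -/
def readSymbol (acc : BitCNF × List Bool) (t : List (Bool × Bool)) : BitCNF × List Bool :=
  caseList t ([] :: acc.1, []) fun p _ =>
    bif p.1 then (acc.1, p.2 :: acc.2) else
      caseList acc.1 ([], []) fun C F => (((acc.2, p.2) :: C) :: F, [])

/-- Read a formula, from right to left. -/
def parse (w : List (List (Bool × Bool))) : BitCNF := (w.foldl readSymbol ([], [])).1

namespace PT

variable {α : Type} [Enc α]

theorem touches {C : α → Clause} {s : α → List ℕ} (hC : PT C) (hs : PT s) :
    PT fun a => touches (C a) (s a) := by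
  unfold StackProg.touches
  exact any hC (mem (fst (snd id)) (comp hs (fst id)))

theorem avoids {x : α → ℕ} {C : α → Clause} {s : α → List ℕ} (hx : PT x) (hC : PT C)
    (hs : PT s) : PT fun a => avoids (x a) (C a) (s a) := by
  unfold StackProg.avoids
  exact and (all hC (not (eq (fst (snd id)) (comp hx (fst id))))) (not (mem hx hs))

theorem conflicts {F : α → CNF} {s : α → List ℕ} (hF : PT F) (hs : PT s) :
    PT fun a => conflicts (F a) (s a) := by
  unfold StackProg.conflicts
  refine flatMap hF (flatMap (comp hF (fst id)) (cond (and ?_ ?_) (flatMap ?_ (flatMap ?_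
    (cond (and ?_ ?_) (cons (pair ?_ ?_) (const [])) (const [])))) (const [])))
  · exact touches (snd (fst id)) (comp hs (fst (fst id)))
  · exact touches (snd id) (comp hs (fst (fst id)))
  · exact snd (fst id)
  · exact snd (fst id)
  · exact avoids (fst (snd (fst id))) (snd (fst (fst id))) (comp hs (fst (fst (fst (fst id)))))
  · exact avoids (fst (snd id)) (snd (fst (fst (fst id)))) (comp hs (fst (fst (fst (fst id)))))
  · exact fst (snd (fst id))
  · exact fst (snd id)

theorem elim {F : α → CNF} {s : α → List ℕ} {A : α → List Clause} (hF : PT F) (hs : PT s)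
    (hA : PT A) : PT fun a => elim (F a) (s a) (A a) := by
  unfold StackProg.elim
  refine filter (map hF (filter (snd id) (not (mem ?_ ?_)))) (all ?_ (any ?_ (all ?_ (mem ?_
    (append ?_ ?_)))))
  · exact fst (snd id)
  · exact comp hs (fst (fst id))
  · exact comp hA (fst id)
  · exact comp hF (fst (fst id))
  · exact snd id
  · exact snd id
  · exact snd (fst (fst id))
  · exact snd (fst (fst (fst id)))

theorem extend {x : α → ℕ} {c : α → Cand} (hx : PT x) (hc : PT c) :
    PT fun a => extend (x a) (c a) := by
  unfold StackProg.extend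
  refine pair (caseList (fst hc) (const []) (snd (snd id))) (pair (cons hx (fst (snd hc)))
    (flatMap (snd (snd hc)) (cons (cons (pair ?_ (const true)) (snd id))
      (cons (cons (pair ?_ (const false)) (snd id)) (const [])))))
  · exact comp hx (fst id)
  · exact comp hx (fst id)

theorem singletons {F : α → CNF} {k : α → List Unit} (hF : PT F) (hk : PT k) :
    PT fun a => singletons (F a) (k a) := by
  unfold StackProg.singletons
  exact flatMap hF (map (snd id) (extend (fst (snd id))
    (pair (cons (const ()) (comp hk (fst (fst id)))) (const ([], [[]])))))

/-- The list of total clauses of a candidate may be exponentially long in the size of its set, but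
it belongs to the state and so counts as input here. The width enters only through the size and the
number of the states. -/
theorem step : PT step := by
  unfold StackProg.step
  refine caseList (snd (snd id)) (pair (fst id) (pair (cons (const ()) (fst (snd id)))
    (singletons (fst id) (cons (const ()) (fst (snd id)))))) (caseList (fst (fst (snd id)))
    (pair (fst (fst id)) (pair (fst (snd (fst id))) (snd (snd id))))
    (caseList (conflicts ?_ ?_) (pair (elim ?_ ?_ ?_) (const ([], []))) (pair ?_ (pair ?_
      (cons (extend ?_ ?_) (cons (extend ?_ ?_) ?_))))))
  · exact fst (fst (fst id))
  · exact fst (snd (fst (snd (fst id))))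
  · exact fst (fst (fst id))
  · exact fst (snd (fst (snd (fst id))))
  · exact snd (snd (fst (snd (fst id))))
  · exact fst (fst (fst (fst id)))
  · exact fst (snd (fst (fst (fst id))))
  · exact fst (fst (snd id))
  · exact fst (snd (fst (fst id)))
  · exact snd (fst (snd id))
  · exact fst (snd (fst (fst id)))
  · exact snd (snd (fst (fst id)))

theorem hasVar {F : α → CNF} (hF : PT F) : PT fun a => hasVar (F a) := by
  unfold StackProg.hasVar
  exact any hF (not (isEmpty (snd id)))

end PT

/-- Growth by a constant per symbol yields the linear bound on accumulators that `PT.foldl` demands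
in the proof of `PT.parse`. -/
theorem sz_readSymbol (acc : BitCNF × List Bool) (t : List (Bool × Bool)) :
    sz (readSymbol acc t) ≤ sz acc + 6 := by
  obtain ⟨F, l⟩ := acc
  have := sz_pos l
  have := sz_pos F
  unfold readSymbol
  cases t with
  | nil => simp; omega
  | cons p t =>
    obtain ⟨_ | _, b⟩ := p
    · have := sz_bool b
      cases F
      · simp
      · simp; omega
    · have := sz_bool b
      simp; omega

namespace PT

variable {α : Type} [Enc α]

theorem parse : PT parse := by
  unfold StackProg.parse
  have hrec : PT fun p : List (List (Bool × Bool)) × (BitCNF × List Bool) × List (Bool × Bool) =>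
      readSymbol p.2.1 p.2.2 := by
    unfold readSymbol
    refine caseList (snd (snd id)) (pair (cons (const []) (fst (fst (snd id)))) (const []))
      (cond (fst (fst (snd id))) (pair ?_ (cons ?_ ?_)) (caseList ?_ (const ([], []))
        (pair (cons (cons (pair ?_ ?_) ?_) ?_) (const []))))
    · exact fst (fst (snd (fst id)))
    · exact snd (fst (snd id))
    · exact snd (fst (snd (fst id)))
    · exact fst (fst (snd (fst id)))
    · exact snd (fst (snd (fst (fst id))))
    · exact snd (fst (snd (fst id)))
    · exact fst (snd id)
    · exact snd (snd id)
  refine fst (foldl (g := fun _ acc t => readSymbol acc t) id (const ([], [])) hrec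
    (bd := fun w => 6 * sz w + 3) (((PolyIn.const 6).mul .self).add (.const 3)) fun w n => ?_)
  have key : ∀ (w : List (List (Bool × Bool))) acc, sz (w.foldl readSymbol acc) ≤
      sz acc + 6 * w.length := by
    intro w
    induction w with
    | nil => simp
    | cons t w ih =>
      intro acc
      have h₁ := ih (readSymbol acc t)
      have h₂ := sz_readSymbol acc t
      simp only [List.foldl_cons, List.length_cons]
      omega
  have h₁ := key (w.take n) ([], [])
  have h₂ := length_lt_sz w
  have h₃ := List.length_take_le' n w
  change sz ((w.take n).foldl readSymbol ([], [])) ≤ _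
  simp only [sz_pair, sz_nil] at h₁ ⊢
  omega

end PT

/-- The formula with the variables replaced by their binary digits. -/
def toBits (F : CNF) : BitCNF := F.map fun C => C.map fun l => (l.1.bits, l.2)

theorem enc_toBits (F : CNF) : enc (toBits F) = enc F := by
  have hC : ∀ C : Clause, enc (C.map fun l => (l.1.bits, l.2)) = enc C := by
    intro C
    induction C with
    | nil => rfl
    | cons l C ih => exact congrArg (Tr.node _) ih
  induction F with
  | nil => rfl
  | cons C F ih => exact congrArg₂ Tr.node (hC C) ih

/-- From right to left the word is read without lookahead: an end marker opens an empty clause,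
digits are collected, and a sign completes a literal. The left fold over the reversed word is a
right fold over the word. -/
theorem parse_encodeCNF (F : CNF) :
    parse ((encodeCNF F).map symbolValue).reverse = toBits F := by
  let f : Symbol → BitCNF × List Bool → BitCNF × List Bool := fun x acc =>
    readSymbol acc (symbolValue x)
  have hbits : ∀ (l : List Bool) G, (l.map Symbol.bit).foldr f (G, []) = (G, l) := by
    intro l G
    induction l with
    | nil => rfl
    | cons b l ih => rw [List.map_cons, List.foldr_cons, ih]; rfl
  have hlit : ∀ (l : Literal) C G, (encodeLiteral l).foldr f (C :: G, []) =
      (((l.1.bits, l.2) :: C) :: G, []) := by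
    rintro ⟨x, _ | _⟩ C G <;> simp only [encodeLiteral, List.foldr_cons, hbits] <;> rfl
  have hlits : ∀ (C : Clause) G, (C.flatMap encodeLiteral).foldr f ([] :: G, []) =
      ((C.map fun l => (l.1.bits, l.2)) :: G, []) := by
    intro C G
    induction C with
    | nil => rfl
    | cons l C ih => rw [List.flatMap_cons, List.foldr_append, ih, hlit]; rfl
  have hF : (encodeCNF F).foldr f ([], []) = (toBits F, []) := by
    induction F with
    | nil => rfl
    | cons C F ih =>
      have h : encodeCNF (C :: F) = C.flatMap encodeLiteral ++ Symbol.clauseEnd :: encodeCNF F := by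
        simp [encodeCNF, encodeClause]
      rw [h, List.foldr_append, List.foldr_cons, ih]
      exact hlits C _
  rw [parse, List.foldl_reverse, List.foldr_map]
  exact congrArg Prod.fst hF

end StackProg

/-! ### Heredity of nest-set width, elimination and conflicts -/

namespace StackProg

open NestSetSAT
open Enc (enc)
open scoped Hypergraph

section Hypergraphs

variable {α : Type*}

/-- `H'` arises from `H` by deleting vertices and edges. -/
def IsPart (H' H : Hypergraph α) : Prop :=
  V(H') ⊆ V(H) ∧ ∀ e' ∈ E(H'), e'.Nonempty → ∃ e ∈ E(H), e' = e ∩ V(H')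

/-- Each set of the ordering is intersected with `V(H')` and omitted if nothing is left. Non-empty
edges of `H'` are traces of edges of `H`, and a chain stays a chain when its members are intersected
with `V(H')`. Empty edges are exempt in `IsPart` because deletion removes them from `H`, while `H'`
may keep them when a set is omitted. -/
theorem IsPart.exists_isKNEO {k : ℕ} {O : List (Set α)} : ∀ {H H' : Hypergraph α},
    IsPart H' H → IsKNEO H k O → ∃ O', IsKNEO H' k O' := by
  induction O with
  | nil =>
    rintro H H' ⟨hV, -⟩ ⟨hO, -⟩
    exact ⟨[], Set.subset_eq_empty hV hO, by simp⟩
  | cons s O ih =>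
    rintro H H' ⟨hV, hE⟩ ⟨⟨⟨-, hsV, hs⟩, hO⟩, hk⟩
    have hrest : IsKNEO (deleteVertices H s) k O :=
      ⟨hO, fun t ht => hk t (List.mem_cons_of_mem _ ht)⟩
    by_cases hne : (s ∩ V(H')).Nonempty
    · have hpart : IsPart (deleteVertices H' (s ∩ V(H'))) (deleteVertices H s) := by
        refine ⟨fun x hx => ⟨hV hx.1, fun hxs => hx.2 ⟨hxs, hx.1⟩⟩, ?_⟩
        rintro _ ⟨⟨x, hx⟩, e', he', rfl⟩ -
        obtain ⟨e, he, h⟩ := hE e' he' ⟨x, hx.1⟩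
        refine ⟨e ∩ (V(H) \ s), ⟨⟨x, ?_⟩, e, he, rfl⟩, ?_⟩
        · rw [h] at hx
          exact ⟨hx.1.1, hV hx.2.1, fun hxs => hx.2.2 ⟨hxs, hx.2.1⟩⟩
        · ext y
          rw [h]
          constructor
          · rintro ⟨⟨h₁, h₂⟩, h₃, h₄⟩
            exact ⟨⟨h₁, hV h₂, fun hy => h₄ ⟨hy, h₂⟩⟩, h₃, h₄⟩
          · rintro ⟨⟨h₁, -, -⟩, h₃, h₄⟩
            exact ⟨⟨h₁, h₃⟩, h₃, h₄⟩
      obtain ⟨O', hO', hk'⟩ := ih hpart hrest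
      refine ⟨(s ∩ V(H')) :: O', ⟨⟨hne, Set.inter_subset_right, ?_⟩, hO'⟩, ?_⟩
      · have key : ∀ e' ∈ incidentEdges H' (s ∩ V(H')), ∃ e ∈ incidentEdges H s,
            e' \ (s ∩ V(H')) = (e \ s) ∩ V(H') := by
          rintro e' ⟨he', v, hv, hve⟩
          obtain ⟨e, he, h⟩ := hE e' he' ⟨v, hve⟩
          refine ⟨e, ⟨he, v, hv.1, ?_⟩, ?_⟩
          · rw [h] at hve
            exact hve.1
          · ext y
            rw [h]
            constructor
            · rintro ⟨⟨h₁, h₂⟩, h₃⟩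
              exact ⟨⟨h₁, fun hy => h₃ ⟨hy, h₂⟩⟩, h₂⟩
            · rintro ⟨⟨h₁, h₂⟩, h₃⟩
              exact ⟨⟨h₁, h₃⟩, fun hy => h₂ hy.1⟩
        rintro _ ⟨e', he', rfl⟩ _ ⟨f', hf', rfl⟩ -
        obtain ⟨e, he, h⟩ := key e' he'
        obtain ⟨f, hf, h'⟩ := key f' hf'
        dsimp only
        rw [h, h']
        rcases hs.total ⟨e, he, rfl⟩ ⟨f, hf, rfl⟩ with h | h
        · exact Or.inl (Set.inter_subset_inter_left _ h)
        · exact Or.inr (Set.inter_subset_inter_left _ h)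
      · intro t ht
        rcases List.mem_cons.1 ht with rfl | ht
        · exact (Set.encard_le_encard Set.inter_subset_left).trans (hk s List.mem_cons_self)
        · exact hk' t ht
    · rw [Set.not_nonempty_iff_eq_empty, ← Set.disjoint_iff_inter_eq_empty] at hne
      have hV' : V(H') ⊆ V(deleteVertices H s) := fun x hx =>
        ⟨hV hx, fun hxs => Set.disjoint_left.1 hne hxs hx⟩
      refine ih (H' := H') ⟨hV', ?_⟩ hrest
      intro e' he' hne'
      obtain ⟨e, he, h⟩ := hE e' he' hne'
      have h' : e' = e ∩ (V(H) \ s) ∩ V(H') := by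
        rw [h]
        ext y
        constructor
        · rintro ⟨h₁, h₂⟩
          exact ⟨⟨h₁, hV h₂, fun hy => Set.disjoint_left.1 hne hy h₂⟩, h₂⟩
        · rintro ⟨⟨h₁, -⟩, h₂⟩
          exact ⟨h₁, h₂⟩
      refine ⟨e ∩ (V(H) \ s), ⟨?_, e, he, rfl⟩, h'⟩
      rw [h'] at hne'
      exact hne'.mono Set.inter_subset_left

end Hypergraphs

/-- `F` has a nest-set elimination ordering of width `K`. -/
def HasNEO (K : ℕ) (F : CNF) : Prop := ∃ O, IsKNEO (formulaHypergraph F) K O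

theorem hasNEO_formulaWidth (F : CNF) : HasNEO (formulaWidth F) F := by
  have hfin : V(formulaHypergraph F).Finite := by
    refine (List.finite_toSet (F.flatMap fun C => C.map Prod.fst)).subset ?_
    rintro v ⟨C, hC, l, hl, rfl⟩
    exact List.mem_flatMap.2 ⟨C, hC, List.mem_map.2 ⟨l, hl, rfl⟩⟩
  exact Nat.sInf_mem (exists_isKNEO (formulaHypergraph F) hfin)

theorem hasVar_iff {F : CNF} : hasVar F = true ↔ ∃ C ∈ F, ∃ l, l ∈ C := by
  simp only [hasVar, List.any_eq_true, Bool.not_eq_true', List.isEmpty_eq_false_iff_exists_mem]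

theorem HasNEO.exists_isNestSet {K : ℕ} {F : CNF} (h : HasNEO K F) (hF : hasVar F = true) :
    ∃ S, IsNestSet (formulaHypergraph F) S ∧ S.encard ≤ K := by
  obtain ⟨C, hC, l, hl⟩ := hasVar_iff.1 hF
  obtain ⟨O, hO, hk⟩ := h
  cases O with
  | nil =>
    have h : l.1 ∈ V(formulaHypergraph F) := ⟨C, hC, l, hl, rfl⟩
    rw [show V(formulaHypergraph F) = ∅ from hO] at h
    exact h.elim
  | cons S O => exact ⟨S, hO.1, hk S List.mem_cons_self⟩

theorem HasNEO.pos {K : ℕ} {F : CNF} (h : HasNEO K F) (hF : hasVar F = true) : 0 < K := by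
  obtain ⟨S, hS, hk⟩ := h.exists_isNestSet hF
  rcases Nat.eq_zero_or_pos K with rfl | h
  · rw [Nat.cast_zero, nonpos_iff_eq_zero, Set.encard_eq_zero] at hk
    exact absurd hS.1 (by simp [hk])
  · exact h

/-- The literals of `a` are the literals of the variables in `s` with the signs given by `σ`. -/
def IsTotal (s : List ℕ) (σ : ℕ → Bool) (a : Clause) : Prop :=
  ∀ l : Literal, l ∈ a ↔ l.1 ∈ s ∧ l.2 = σ l.1

/-- Up to repetitions, `A` consists of the clauses with exactly one literal of each variable
in `s`. -/
def IsComplete (s : List ℕ) (A : List Clause) : Prop :=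
  (∀ σ, ∃ a ∈ A, IsTotal s σ a) ∧ ∀ a ∈ A, ∃ σ, IsTotal s σ a

theorem mem_elim {F : CNF} {s : List ℕ} {A : List Clause} {D : Clause} :
    D ∈ elim F s A ↔ (∃ C ∈ F, C.filter (fun l => !decide (l.1 ∈ s)) = D) ∧
      ∀ a ∈ A, ∃ C ∈ F, ∀ l ∈ C, l ∈ a ∨ l ∈ D := by
  simp [elim, List.mem_filter]

/-- Take for `a` the total clause falsified by `τ`. Some clause of `F` lies in `a ∪ D`, and the
literal that `τ` makes true in it cannot be in `a`. That `s` is a nest-set plays no role in this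
direction. -/
theorem satisfiable_elim_of_satisfiable {F : CNF} {s : List ℕ} {A : List Clause}
    (hA : IsComplete s A) (hF : Satisfiable F) : Satisfiable (elim F s A) := by
  obtain ⟨τ, hτ⟩ := hF
  refine ⟨τ, fun D hD => ?_⟩
  obtain ⟨a, haA, ha⟩ := hA.1 fun x => !τ x
  obtain ⟨C, hC, h⟩ := (mem_elim.1 hD).2 a haA
  obtain ⟨l, hl, hτl⟩ := hτ C hC
  refine ⟨l, (h l hl).resolve_left fun hla => ?_, hτl⟩
  have := ((ha l).1 hla).2
  simp [hτl] at this

theorem touches_iff {C : Clause} {s : List ℕ} : touches C s = true ↔ ∃ l ∈ C, l.1 ∈ s := by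
  simp [touches]

theorem avoids_iff {x : ℕ} {C : Clause} {s : List ℕ} :
    avoids x C s = true ↔ (∀ l ∈ C, l.1 ≠ x) ∧ x ∉ s := by
  simp [avoids]

theorem mem_conflicts {F : CNF} {s : List ℕ} {p : ℕ × ℕ} :
    p ∈ conflicts F s ↔ ∃ C ∈ F, ∃ C' ∈ F, touches C s = true ∧ touches C' s = true ∧
      ∃ l ∈ C, ∃ l' ∈ C', avoids l.1 C' s = true ∧ avoids l'.1 C s = true ∧
        p = (l.1, l'.1) := by
  simp only [conflicts, List.mem_flatMap]
  constructor
  · rintro ⟨C, hC, C', hC', h⟩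
    cases ht : touches C s && touches C' s with
    | false => simp [ht] at h
    | true =>
      rw [ht, cond_true, List.mem_flatMap] at h
      obtain ⟨l, hl, h⟩ := h
      obtain ⟨l', hl', h⟩ := List.mem_flatMap.1 h
      cases ha : avoids l.1 C' s && avoids l'.1 C s with
      | false => simp [ha] at h
      | true =>
        rw [ha, cond_true, List.mem_singleton] at h
        rw [Bool.and_eq_true] at ht ha
        exact ⟨C, hC, C', hC', ht.1, ht.2, l, hl, l', hl', ha.1, ha.2, h⟩
  · rintro ⟨C, hC, C', hC', ht, ht', l, hl, l', hl', ha, ha', rfl⟩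
    refine ⟨C, hC, C', hC', ?_⟩
    rw [ht, ht', Bool.and_self, cond_true]
    refine List.mem_flatMap.2 ⟨l, hl, List.mem_flatMap.2 ⟨l', hl', ?_⟩⟩
    rw [ha, ha']
    simp

/-- The variables of `C` outside `s`. -/
def outside (s : List ℕ) (C : Clause) : Set ℕ := {x | x ∉ s ∧ ∃ l ∈ C, l.1 = x}

theorem outside_total {F : CNF} {s : List ℕ} (h : conflicts F s = []) {C C' : Clause} (hC : C ∈ F)
    (hC' : C' ∈ F) (ht : touches C s = true) (ht' : touches C' s = true) :
    outside s C ⊆ outside s C' ∨ outside s C' ⊆ outside s C := by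
  by_contra! hcon
  obtain ⟨⟨x, ⟨hx, l, hl, rfl⟩, hxC⟩, ⟨y, ⟨hy, l', hl', rfl⟩, hyC⟩⟩ :=
    And.imp Set.not_subset.1 Set.not_subset.1 hcon
  have : (l.1, l'.1) ∈ conflicts F s := mem_conflicts.2 ⟨C, hC, C', hC', ht, ht', l, hl, l', hl',
    avoids_iff.2 ⟨fun m hm e => hxC ⟨hx, m, hm, e⟩, hx⟩,
    avoids_iff.2 ⟨fun m hm e => hyC ⟨hy, m, hm, e⟩, hy⟩, rfl⟩
  rw [h] at this
  simp at this

/-- This is where the chain condition is needed: it makes one restriction dominate the violated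
clauses of all total clauses simultaneously. -/
theorem satisfiable_of_satisfiable_elim {F : CNF} {s : List ℕ} {A : List Clause}
    (hA : IsComplete s A) (hs : conflicts F s = []) (hF : Satisfiable (elim F s A)) :
    Satisfiable F := by
  classical
  obtain ⟨τ, hτ⟩ := hF
  by_contra hunsat
  -- A clause violated by the assignment that falsifies `a` on `s` and follows `τ` elsewhere.
  have hfalse : ∀ a : {a // a ∈ A}, ∃ C ∈ F, ∀ l ∈ C, (l.1 ∈ s → l ∈ a.1) ∧
      (l.1 ∉ s → τ l.1 ≠ l.2) := by
    rintro ⟨a, ha⟩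
    obtain ⟨σ, hσ⟩ := hA.2 a ha
    by_contra! hcon
    refine hunsat ⟨fun x => if x ∈ s then !σ x else τ x, fun C hC => ?_⟩
    obtain ⟨l, hl, h⟩ := hcon C hC
    refine ⟨l, hl, ?_⟩
    by_cases hls : l.1 ∈ s
    · by_cases hla : l ∈ a
      · exact absurd hls (h fun _ => hla).1
      · have := fun e => hla ((hσ l).2 ⟨hls, e⟩)
        simp only [hls, if_true]
        revert this
        cases σ l.1 <;> cases l.2 <;> simp
    · simp only [hls, if_false]
      exact (h fun h => absurd h hls).2
  choose C hCF hC using hfalse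
  -- Since `τ` falsifies the restriction of `C b`, that restriction cannot have been kept.
  have hD : ∀ b : {a // a ∈ A},
      ¬ ∀ a ∈ A, ∃ C' ∈ F, ∀ l ∈ C', l ∈ a ∨ l ∈ (C b).filter (fun l => !decide (l.1 ∈ s)) := by
    intro b h
    obtain ⟨l, hl, hτl⟩ := hτ _ (mem_elim.2 ⟨⟨C b, hCF b, rfl⟩, h⟩)
    rw [List.mem_filter] at hl
    exact (hC b l hl.1).2 (by simpa using hl.2) hτl
  -- A clause without variables in `s` equals its own restriction and would justify keeping it, for
  -- every `a`.
  have htouch : ∀ b, touches (C b) s = true := by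
    intro b
    by_contra h
    rw [touches_iff] at h
    push Not at h
    exact hD b fun a _ => ⟨C b, hCF b, fun l hl => Or.inr (List.mem_filter.2 ⟨hl, by
      simpa using h l hl⟩)⟩
  obtain ⟨a₀, ha₀, -⟩ := hA.1 fun _ => true
  have : Finite {a // a ∈ A} := List.finite_toSet A
  have : Nonempty {a // a ∈ A} := ⟨a₀, ha₀⟩
  have hfin : ∀ C : Clause, (outside s C).Finite := fun C =>
    (List.finite_toSet (C.map Prod.fst)).subset fun x ⟨_, l, hl, e⟩ => List.mem_map.2 ⟨l, hl, e⟩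
  obtain ⟨b, hb⟩ := Finite.exists_max fun a => (outside s (C a)).ncard
  have hmax : ∀ a, outside s (C a) ⊆ outside s (C b) := fun a => by
    rcases outside_total hs (hCF a) (hCF b) (htouch a) (htouch b) with h | h
    · exact h
    · exact (Set.eq_of_subset_of_ncard_le h (hb a) (hfin _)).symm.subset
  refine hD b fun a ha => ⟨C ⟨a, ha⟩, hCF _, fun l hl => ?_⟩
  by_cases hls : l.1 ∈ s
  · exact Or.inl ((hC ⟨a, ha⟩ l hl).1 hls)
  · obtain ⟨-, l', hl', e⟩ := hmax ⟨a, ha⟩ ⟨hls, l, hl, rfl⟩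
    have h₁ := (hC ⟨a, ha⟩ l hl).2 hls
    have h₂ := (hC b l' hl').2 (by rwa [e])
    -- Two literals of the same variable that are both false under `τ` have the same sign.
    have : l' = l := Prod.ext e (by
      rw [e] at h₂
      revert h₁ h₂
      cases τ l.1 <;> cases l.2 <;> cases l'.2 <;> simp)
    exact Or.inr (List.mem_filter.2 ⟨this ▸ hl', by simpa using hls⟩)

theorem satisfiable_elim_iff {F : CNF} {s : List ℕ} {A : List Clause}
    (hA : IsComplete s A) (hs : conflicts F s = []) :
    Satisfiable (elim F s A) ↔ Satisfiable F :=
  ⟨satisfiable_of_satisfiable_elim hA hs, satisfiable_elim_of_satisfiable hA⟩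

/-- A kept clause has lost exactly its variables in `s`, and no variable in `s` survives anywhere;
so its edge is the trace of an old edge on the new vertex set. No condition on `s` is involved. -/
theorem HasNEO.elim {K : ℕ} {F : CNF} (h : HasNEO K F) (s : List ℕ) (A : List Clause) :
    HasNEO K (elim F s A) := by
  obtain ⟨O, hO⟩ := h
  have hmem : ∀ D ∈ StackProg.elim F s A, ∃ C ∈ F, ∀ l, l ∈ D ↔ l ∈ C ∧ l.1 ∉ s := by
    intro D hD
    obtain ⟨⟨C, hC, rfl⟩, -⟩ := mem_elim.1 hD
    exact ⟨C, hC, fun l => by simp [List.mem_filter]⟩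
  refine IsPart.exists_isKNEO ⟨?_, ?_⟩ hO
  · rintro _ ⟨D, hD, l, hl, rfl⟩
    obtain ⟨C, hC, h⟩ := hmem D hD
    exact ⟨C, hC, l, ((h l).1 hl).1, rfl⟩
  · rintro _ ⟨D, hD, rfl⟩ -
    obtain ⟨C, hC, h⟩ := hmem D hD
    refine ⟨clauseVars C, ⟨C, hC, rfl⟩, ?_⟩
    ext x
    constructor
    · rintro ⟨l, hl, rfl⟩
      exact ⟨⟨l, ((h l).1 hl).1, rfl⟩, D, hD, l, hl, rfl⟩
    · rintro ⟨⟨l, hl, rfl⟩, D', hD', l', hl', e⟩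
      obtain ⟨C', -, h'⟩ := hmem D' hD'
      exact ⟨l, (h l).2 ⟨hl, e ▸ ((h' l').1 hl').2⟩, rfl⟩

/-- The two edges of the conflict are incident to `s`, hence to `S`. If both variables lay outside
`S`, they would make the edges incomparable after removal of `S`. -/
theorem mem_or_mem_of_isNestSet {F : CNF} {S : Set ℕ} (hS : IsNestSet (formulaHypergraph F) S)
    {s : List ℕ} (hs : ∀ x ∈ s, x ∈ S) {p : ℕ × ℕ} (hp : p ∈ conflicts F s) :
    p.1 ∈ S ∨ p.2 ∈ S := by
  obtain ⟨C, hC, C', hC', ht, ht', l, hl, l', hl', ha, ha', rfl⟩ := mem_conflicts.1 hp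
  have hinc : ∀ C ∈ F, touches C s = true →
      clauseVars C ∈ incidentEdges (formulaHypergraph F) S := by
    intro C hC h
    obtain ⟨m, hm, hms⟩ := touches_iff.1 h
    exact ⟨⟨C, hC, rfl⟩, m.1, hs _ hms, m, hm, rfl⟩
  by_contra! hcon
  rcases hS.2.2.total ⟨_, hinc C hC ht, rfl⟩ ⟨_, hinc C' hC' ht', rfl⟩ with h | h
  · obtain ⟨⟨m, hm, e⟩, -⟩ := h ⟨⟨l, hl, rfl⟩, hcon.1⟩
    exact (avoids_iff.1 ha).1 m hm e
  · obtain ⟨⟨m, hm, e⟩, -⟩ := h ⟨⟨l', hl', rfl⟩, hcon.2⟩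
    exact (avoids_iff.1 ha').1 m hm e

theorem not_mem_of_mem_conflicts {F : CNF} {s : List ℕ} {p : ℕ × ℕ} (hp : p ∈ conflicts F s) :
    (p.1 ∉ s ∧ ∃ C ∈ F, ∃ l ∈ C, l.1 = p.1) ∧ p.2 ∉ s ∧ ∃ C ∈ F, ∃ l ∈ C, l.1 = p.2 := by
  obtain ⟨C, hC, C', hC', -, -, l, hl, l', hl', ha, ha', rfl⟩ := mem_conflicts.1 hp
  exact ⟨⟨(avoids_iff.1 ha).2, C, hC, l, hl, rfl⟩, (avoids_iff.1 ha').2, C', hC', l', hl', rfl⟩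

theorem IsComplete.nil : IsComplete [] [[]] :=
  ⟨fun _ => ⟨[], by simp, fun l => by simp⟩, fun a ha => ⟨fun _ => true, fun l => by simp_all⟩⟩

theorem IsComplete.extend {c : Cand} (h : IsComplete c.2.1 c.2.2) {x : ℕ} (hx : x ∉ c.2.1) :
    IsComplete (extend x c).2.1 (extend x c).2.2 := by
  obtain ⟨b, s, A⟩ := c
  dsimp only at h hx
  constructor
  · intro σ
    obtain ⟨a, ha, hσ⟩ := h.1 σ
    refine ⟨(x, σ x) :: a, List.mem_flatMap.2 ⟨a, ha, ?_⟩, fun l => ?_⟩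
    · cases σ x <;> simp
    · simp only [StackProg.extend, List.mem_cons, hσ l, Prod.ext_iff]
      constructor
      · rintro (⟨h, h'⟩ | ⟨h, h'⟩)
        · exact ⟨Or.inl h, by rw [h', h]⟩
        · exact ⟨Or.inr h, h'⟩
      · rintro ⟨h | h, h'⟩
        · exact Or.inl ⟨h, by rw [h', h]⟩
        · exact Or.inr ⟨h, h'⟩
  · intro a ha
    obtain ⟨a', ha', haa'⟩ := List.mem_flatMap.1 ha
    obtain ⟨σ, hσ⟩ := h.2 a' ha'
    have : ∃ v, a = (x, v) :: a' := by
      simp only [List.mem_cons, List.not_mem_nil, or_false] at haa'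
      rcases haa' with h | h
      · exact ⟨_, h⟩
      · exact ⟨_, h⟩
    obtain ⟨v, rfl⟩ := this
    refine ⟨Function.update σ x v, fun l => ?_⟩
    simp only [StackProg.extend, List.mem_cons, hσ l, Prod.ext_iff]
    by_cases hl : l.1 = x
    · simp [hl, hx]
    · simp [hl]

end StackProg

/-! ### The invariant, the potential and the sizes of states -/

namespace StackProg

open NestSetSAT
open Enc (enc)
open scoped Hypergraph

/-- The variables of a formula, with repetitions. -/
def vars (F : CNF) : List ℕ := F.flatMap fun C => C.map Prod.fst

theorem mem_vars {F : CNF} {x : ℕ} : x ∈ vars F ↔ ∃ C ∈ F, ∃ l ∈ C, l.1 = x := by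
  simp only [vars, List.mem_flatMap, List.mem_map]

theorem length_vars_le (F : CNF) : (vars F).length ≤ sz F := by
  induction F with
  | nil => simp [vars]
  | cons C F ih =>
    have := length_lt_sz C
    simp only [vars, List.flatMap_cons, List.length_append, List.length_map, sz_cons] at *
    omega

theorem sz_le_of_mem_vars {F : CNF} {x : ℕ} (h : x ∈ vars F) : sz x ≤ sz F := by
  obtain ⟨C, hC, l, hl, rfl⟩ := mem_vars.1 h
  have h₁ := sz_lt_of_mem hC
  have h₂ := sz_lt_of_mem hl
  rw [sz_pair] at h₂
  omega

theorem sz_filter_le {α : Type} [Enc α] (p : α → Bool) (l : List α) : sz (l.filter p) ≤ sz l := by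
  induction l with
  | nil => simp
  | cons a l ih =>
    rw [List.filter_cons]
    split
    · simp; omega
    · simp; omega

theorem sz_elim_le (F : CNF) (s : List ℕ) (A : List Clause) : sz (elim F s A) ≤ sz F := by
  refine (sz_filter_le _ _).trans ?_
  induction F with
  | nil => simp
  | cons C F ih =>
    have := sz_filter_le (fun l : Literal => !decide (l.1 ∈ s)) C
    rw [List.map_cons, sz_cons, sz_cons]
    omega

theorem card_vars_elim_lt {F : CNF} {s : List ℕ} {A : List Clause} {x : ℕ} (hx : x ∈ s)
    (hF : x ∈ vars F) : (vars (elim F s A)).toFinset.card < (vars F).toFinset.card := by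
  have key : ∀ y ∈ vars (elim F s A), y ∈ vars F ∧ y ∉ s := by
    intro y hy
    obtain ⟨D, hD, l, hl, rfl⟩ := mem_vars.1 hy
    obtain ⟨⟨C, hC, rfl⟩, -⟩ := mem_elim.1 hD
    rw [List.mem_filter] at hl
    exact ⟨mem_vars.2 ⟨C, hC, l, hl.1, rfl⟩, by simpa using hl.2⟩
  refine Finset.card_lt_card ⟨fun y hy => ?_, fun h => ?_⟩
  · exact List.mem_toFinset.2 (key y (List.mem_toFinset.1 hy)).1
  · exact (key x (List.mem_toFinset.1 (h (List.mem_toFinset.2 hF)))).2 hx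

/-- The candidates that occur while nest-sets of size `k` are searched for. -/
structure GoodCand (F : CNF) (k : ℕ) (c : Cand) : Prop where
  nodup : c.2.1.Nodup
  budget : c.1.length + c.2.1.length = k + 1
  complete : IsComplete c.2.1 c.2.2
  mem_vars : ∀ x ∈ c.2.1, x ∈ vars F
  length_eq : c.2.2.length = 2 ^ c.2.1.length
  clauses : ∀ a ∈ c.2.2, a.length = c.2.1.length ∧ ∀ l ∈ a, l.1 ∈ vars F

theorem GoodCand.extend {F : CNF} {k : ℕ} {c : Cand} (h : GoodCand F k c) (hc : c.1 ≠ []) {x : ℕ}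
    (hx : x ∉ c.2.1) (hxF : x ∈ vars F) : GoodCand F k (extend x c) where
  nodup := List.nodup_cons.2 ⟨hx, h.nodup⟩
  budget := by
    obtain ⟨_ | ⟨u, b⟩, s, A⟩ := c
    · exact absurd rfl hc
    · have := h.budget
      simp [StackProg.extend] at this ⊢
      omega
  complete := h.complete.extend hx
  mem_vars := by
    intro y hy
    rcases List.mem_cons.1 hy with rfl | hy
    · exact hxF
    · exact h.mem_vars y hy
  length_eq := by
    simp only [StackProg.extend, List.length_flatMap, List.length_cons, List.length_nil,
      List.map_const', List.sum_replicate, smul_eq_mul, h.length_eq, pow_succ]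
  clauses := by
    intro a ha
    obtain ⟨a', ha', haa'⟩ := List.mem_flatMap.1 ha
    obtain ⟨h₁, h₂⟩ := h.clauses a' ha'
    have : ∃ v, a = (x, v) :: a' := by
      simp only [List.mem_cons, List.not_mem_nil, or_false] at haa'
      rcases haa' with h | h
      · exact ⟨_, h⟩
      · exact ⟨_, h⟩
    obtain ⟨v, rfl⟩ := this
    refine ⟨by simp [StackProg.extend, h₁], fun l hl => ?_⟩
    rcases List.mem_cons.1 hl with rfl | hl
    · exact hxF
    · exact h₂ l hl

/-- The invariant of the search, for an input `F₀` of nest-set width at most `K`. -/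
structure Inv (K : ℕ) (F₀ : CNF) (q : State) : Prop where
  neo : HasNEO K q.1
  le : q.2.1.length ≤ K
  good : ∀ c ∈ q.2.2, GoodCand q.1 q.2.1.length c ∧ c.2.1 ≠ []
  search : hasVar q.1 = true → q.2.1.length = K →
    ∃ S, IsNestSet (formulaHypergraph q.1) S ∧ S.encard ≤ K ∧ ∃ c ∈ q.2.2, ∀ x ∈ c.2.1, x ∈ S
  size : sz q.1 ≤ sz F₀
  sat : Satisfiable q.1 ↔ Satisfiable F₀

/-- The `search` clause speaks only of the bound `K`, as a search with a smaller bound may fail.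
With bound 0 it is vacuous, since a formula with a variable forces `K > 0`. -/
theorem Inv.init {K : ℕ} {F : CNF} (h : HasNEO K F) : Inv K F (F, [], []) where
  neo := h
  le := Nat.zero_le _
  good := by simp
  search hF h' := absurd h' (h.pos hF).ne
  size := le_rfl
  sat := Iff.rfl

/-- An upper bound for the number of steps that remain. -/
def potential (K L : ℕ) (q : State) : ℕ :=
  (vars q.1).toFinset.card * ((K + 1) * (L * 3 ^ K + 1)) +
    (K - q.2.1.length) * (L * 3 ^ K + 1) + (q.2.2.map fun c => 3 ^ c.1.length).sum

theorem mem_singletons {F : CNF} {k : List Unit} {c : Cand} :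
    c ∈ singletons F k ↔ ∃ C ∈ F, ∃ l ∈ C, extend l.1 (() :: k, [], [[]]) = c := by
  simp only [singletons, List.mem_flatMap, List.mem_map]

theorem length_singletons (F : CNF) (k : List Unit) :
    (singletons F k).length = (vars F).length := by
  simp [singletons, vars, List.length_flatMap]

/-- With `L = sz F₀`, a new round spends `L * 3 ^ K + 1` and creates at most `L` candidates of
weight at most `3 ^ K`. Discarding a candidate frees its weight 1, and branching replaces `3 ^ (b +
1)` by `2 * 3 ^ b`. An elimination removes a variable, which pays for the rounds of a fresh search.
-/
theorem Inv.step {K : ℕ} {F₀ : CNF} {q : State} (h : Inv K F₀ q) (hq : hasVar q.1 = true) :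
    Inv K F₀ (step q) ∧ potential K (sz F₀) (step q) < potential K (sz F₀) q := by
  obtain ⟨F, k, w⟩ := q
  cases w with
  | nil =>
    -- At bound `K` some candidate always lies inside a nest-set, so the list cannot run empty.
    have hk : k.length < K := lt_of_le_of_ne h.le fun e => by
      obtain ⟨S, -, -, c, hc, -⟩ := h.search hq e
      simp at hc
    refine ⟨⟨h.neo, hk, ?_, ?_, h.size, h.sat⟩, ?_⟩
    · intro c hc
      obtain ⟨C, hC, l, hl, rfl⟩ := mem_singletons.1 hc
      -- The seed is the empty set with a budget one above the new bound. The budget is therefore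
      -- used up exactly when a set exceeds the bound by one.
      refine ⟨GoodCand.extend (k := k.length + 1) ⟨by simp, by simp, .nil, by simp, by simp,
        by simp⟩ (by simp) (by simp) (mem_vars.2 ⟨C, hC, l, hl, rfl⟩), by simp [extend]⟩
    · intro _ _
      obtain ⟨S, hS, hSK⟩ := h.neo.exists_isNestSet hq
      refine ⟨S, hS, hSK, ?_⟩
      obtain ⟨x, hx⟩ := hS.1
      obtain ⟨C, hC, l, hl, rfl⟩ := hS.2.1 hx
      exact ⟨_, mem_singletons.2 ⟨C, hC, l, hl, rfl⟩, by simpa [extend] using hx⟩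
    · have hsum : ((singletons F (() :: k)).map fun c => 3 ^ c.1.length).sum ≤ sz F₀ * 3 ^ K := by
        refine (List.sum_le_card_nsmul _ (3 ^ K) fun m hm => ?_).trans ?_
        · obtain ⟨c, hc, rfl⟩ := List.mem_map.1 hm
          obtain ⟨C, hC, l, hl, rfl⟩ := mem_singletons.1 hc
          exact Nat.pow_le_pow_right (by omega) hk
        · rw [List.length_map, length_singletons, smul_eq_mul]
          exact Nat.mul_le_mul_right _ ((length_vars_le F).trans h.size)
      have e : K - k.length = (K - (k.length + 1)) + 1 := by omega
      simp only [potential, StackProg.step, caseList_nil, List.map_nil, List.sum_nil,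
        List.length_cons]
      rw [e, Nat.succ_mul (K - (k.length + 1))]
      omega
  | cons c w =>
    obtain ⟨hc, hne⟩ := h.good c List.mem_cons_self
    have hgood : ∀ c ∈ w, GoodCand F k.length c ∧ c.2.1 ≠ [] := fun c hc =>
      h.good c (List.mem_cons_of_mem _ hc)
    obtain ⟨b, s, A⟩ := c
    cases b with
    | nil =>
      refine ⟨⟨h.neo, h.le, hgood, ?_, h.size, h.sat⟩, ?_⟩
      -- The discarded set has `K + 1` elements, too many to lie inside `S`; the candidate inside
      -- `S` is another one.
      · intro hF hk
        obtain ⟨S, hS, hSK, c, hcw, hcS⟩ := h.search hF hk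
        refine ⟨S, hS, hSK, c, (List.mem_cons.1 hcw).resolve_left ?_, hcS⟩
        rintro rfl
        have h₁ := hc.budget
        have h₂ := List.toFinset_card_of_nodup hc.nodup
        have h₃ : ((s.toFinset : Finset ℕ) : Set ℕ).encard ≤ S.encard :=
          Set.encard_le_encard fun x hx => hcS x (by simpa using hx)
        rw [Set.encard_coe_eq_coe_finsetCard] at h₃
        have h₄ := h₃.trans hSK
        rw [Nat.cast_le, h₂] at h₄
        change 0 + s.length = k.length + 1 at h₁
        change s.length ≤ K at h₄
        change k.length = K at hk
        omega
      · simp [potential, StackProg.step]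
    | cons u b =>
      cases hconf : conflicts F s with
      | nil =>
        have hstep : StackProg.step (F, k, (u :: b, s, A) :: w) = (elim F s A, [], []) := by
          simp [StackProg.step, hconf]
        rw [hstep]
        have hneo := h.neo.elim s A
        refine ⟨⟨hneo, Nat.zero_le _, by simp, fun hF hk => absurd hk (hneo.pos hF).ne,
          (sz_elim_le F s A).trans h.size, (satisfiable_elim_iff hc.complete hconf).trans h.sat⟩,
          ?_⟩
        obtain ⟨x, hx⟩ := List.exists_mem_of_ne_nil s hne
        have hlt : (vars (elim F s A)).toFinset.card < (vars F).toFinset.card :=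
          card_vars_elim_lt hx (hc.mem_vars x hx)
        simp only [potential, List.length_nil, List.map_nil, List.sum_nil]
        -- A variable is worth `K + 1` rounds, whereas resetting the bound to 0 gives back at most
        -- `K`.
        have h₁ := Nat.mul_le_mul_right ((K + 1) * (sz F₀ * 3 ^ K + 1)) (Nat.succ_le_of_lt hlt)
        rw [Nat.succ_mul] at h₁
        have h₂ : (K + 1) * (sz F₀ * 3 ^ K + 1) = K * (sz F₀ * 3 ^ K + 1) + (sz F₀ * 3 ^ K + 1) :=
          Nat.succ_mul _ _
        simp only [Nat.sub_zero]
        omega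
      | cons p r =>
        have hstep : StackProg.step (F, k, (u :: b, s, A) :: w) =
            (F, k, extend p.1 (u :: b, s, A) :: extend p.2 (u :: b, s, A) :: w) := by
          simp [StackProg.step, hconf]
        rw [hstep]
        have hp : p ∈ conflicts F s := by simp [hconf]
        obtain ⟨⟨h₁, h₁'⟩, h₂, h₂'⟩ := not_mem_of_mem_conflicts hp
        refine ⟨⟨h.neo, h.le, ?_, ?_, h.size, h.sat⟩, ?_⟩
        · intro c hcw
          rcases List.mem_cons.1 hcw with rfl | hcw
          · exact ⟨hc.extend (by simp) h₁ (mem_vars.2 h₁'), by simp [extend]⟩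
          rcases List.mem_cons.1 hcw with rfl | hcw
          · exact ⟨hc.extend (by simp) h₂ (mem_vars.2 h₂'), by simp [extend]⟩
          · exact hgood c hcw
        · intro hF hk
          obtain ⟨S, hS, hSK, c, hcw, hcS⟩ := h.search hF hk
          refine ⟨S, hS, hSK, ?_⟩
          rcases List.mem_cons.1 hcw with rfl | hcw
          -- `S` contains one of the two variables, so one of the two extensions stays inside `S`.
          · rcases mem_or_mem_of_isNestSet hS hcS hp with hpS | hpS
            · refine ⟨_, List.mem_cons_self, fun x hx => ?_⟩
              rcases List.mem_cons.1 hx with rfl | hx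
              exacts [hpS, hcS x hx]
            · refine ⟨_, List.mem_cons_of_mem _ List.mem_cons_self, fun x hx => ?_⟩
              rcases List.mem_cons.1 hx with rfl | hx
              exacts [hpS, hcS x hx]
          · exact ⟨c, by simp [hcw], hcS⟩
        · have : 0 < 3 ^ b.length := by positivity
          simp only [potential, extend, caseList_cons, List.map_cons, List.sum_cons,
            List.length_cons, pow_succ]
          omega

/-- The bound on `φ` along the whole orbit is recorded because the potential controls the sizes of
the states as well as the number of steps. -/
theorem exists_iterate {α : Type*} {f : α → α} {p : α → Bool} {I : α → Prop} {φ : α → ℕ}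
    (h : ∀ a, I a → p a = true → I (f a) ∧ φ (f a) < φ a) : ∀ {a : α}, I a →
    ∃ N ≤ φ a, (∀ i < N, p (f^[i] a) = true) ∧ p (f^[N] a) = false ∧
      ∀ i ≤ N, I (f^[i] a) ∧ φ (f^[i] a) ≤ φ a := by
  intro a
  induction hn : φ a using Nat.strong_induction_on generalizing a with
  | _ n ih =>
    intro ha
    cases hp : p a with
    | false => exact ⟨0, Nat.zero_le _, by simp, hp, by simp [ha, hn]⟩
    | true =>
      obtain ⟨h₁, h₂⟩ := h a ha hp
      obtain ⟨N, hN, hlt, hNp, hI⟩ := ih _ (hn ▸ h₂) rfl h₁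
      refine ⟨N + 1, by omega, ?_, hNp, ?_⟩
      · intro i hi
        cases i with
        | zero => exact hp
        | succ i => exact hlt i (by omega)
      · intro i hi
        cases i with
        | zero => exact ⟨ha, hn.le⟩
        | succ i =>
          obtain ⟨h₃, h₄⟩ := hI i (by omega)
          exact ⟨h₃, by rw [Function.iterate_succ_apply]; omega⟩

theorem satisfiable_iff_of_not_hasVar {F : CNF} (h : hasVar F = false) :
    Satisfiable F ↔ F.isEmpty = true := by
  cases F with
  | nil => simp [Satisfiable, Satisfies]
  | cons C F =>
    have hC : C = [] := by
      by_contra hne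
      obtain ⟨l, hl⟩ := List.exists_mem_of_ne_nil C hne
      have := hasVar_iff.2 ⟨C, List.mem_cons_self (l := F), l, hl⟩
      rw [h] at this
      simp at this
    simp [Satisfiable, Satisfies, hC]

theorem sz_list_unit (l : List Unit) : sz l = 2 * l.length + 1 := by
  induction l with
  | nil => rfl
  | cons u l ih =>
    have : sz u = 1 := rfl
    simp [ih, this]; omega

/-- A bound for the size of a candidate. -/
def candBound (K L : ℕ) : ℕ :=
  (2 * (K + 1) + 1) + ((K + 1) * (L + 1) + 1) +
    (2 ^ (K + 1) * ((K + 1) * (L + 5) + 1 + 1) + 1) + 2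

theorem GoodCand.sz_le {F : CNF} {k K L : ℕ} {c : Cand} (h : GoodCand F k c) (hk : k ≤ K)
    (hL : sz F ≤ L) : sz c ≤ candBound K L := by
  obtain ⟨b, s, A⟩ := c
  have hbud := h.budget
  have hs : s.length ≤ K + 1 := by simp at hbud; omega
  have hb : sz b ≤ 2 * (K + 1) + 1 := by
    rw [sz_list_unit]; simp at hbud; omega
  have hs' : sz s ≤ (K + 1) * (L + 1) + 1 :=
    (sz_list_le fun x hx => (sz_le_of_mem_vars (h.mem_vars x hx)).trans hL).trans
      (Nat.add_le_add_right (Nat.mul_le_mul_right _ hs) _)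
  have hA : sz A ≤ 2 ^ (K + 1) * ((K + 1) * (L + 5) + 1 + 1) + 1 := by
    -- A literal has size at most `L + 4`: `L` for the variable, 3 for the sign, 1 for the pair. A
    -- clause in the list has at most `K + 1` of them.
    refine (sz_list_le (B := (K + 1) * (L + 5) + 1) fun a ha => ?_).trans
      (Nat.add_le_add_right (Nat.mul_le_mul_right _ ?_) _)
    · obtain ⟨h₁, h₂⟩ := h.clauses a ha
      refine (sz_list_le (B := L + 4) fun l hl => ?_).trans
        (Nat.add_le_add_right (Nat.mul_le_mul_right _ (h₁.trans_le hs)) _)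
      have h₃ := (sz_le_of_mem_vars (h₂ l hl)).trans hL
      have h₄ := sz_bool l.2
      rw [sz_pair]
      omega
    · exact h.length_eq.trans_le (Nat.pow_le_pow_right (by omega) hs)
  simp only [sz_pair, candBound]
  omega

/-- Each waiting candidate adds at least 1 to the potential, so the potential bounds the length of
the list. -/
theorem Inv.sz_le {K : ℕ} {F₀ : CNF} {q : State} (h : Inv K F₀ q) :
    sz q ≤ sz F₀ + (2 * K + 1) +
      (potential K (sz F₀) q * (candBound K (sz F₀) + 1) + 1) + 2 := by
  obtain ⟨F, k, w⟩ := q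
  have hk := h.le
  have hF := h.size
  have hlen : w.length ≤ potential K (sz F₀) (F, k, w) := by
    refine le_trans ?_ (Nat.le_add_left _ _)
    have := List.card_nsmul_le_sum (w.map fun c => 3 ^ c.1.length) 1 fun m hm => by
      obtain ⟨c, -, rfl⟩ := List.mem_map.1 hm
      exact Nat.one_le_pow _ _ (by omega)
    simpa using this
  have hw : sz w ≤ potential K (sz F₀) (F, k, w) * (candBound K (sz F₀) + 1) + 1 :=
    (sz_list_le fun c hc => (h.good c hc).1.sz_le h.le h.size).trans
      (Nat.add_le_add_right (Nat.mul_le_mul_right _ hlen) _)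
  have hk' := sz_list_unit k
  simp only [sz_pair] at *
  omega

end StackProg

/-! ### Input, output and the total running time -/

namespace StackProg

open Turing Function NestSetSAT
open Enc (enc)

/-- Pop a symbol of the input. -/
def popInput : P := .pop (Sum.inl false) fun v x => (v.1, v.2.1, x, v.2.2.2)

theorem run_popInput (I O A S T U C) (v : Mem) :
    Run popInput v (mk I O A S T U C) 1 (v.1, v.2.1, I.head?, v.2.2.2)
      (mk I.tail O A S T U C) := by
  have := Run.pop (Γ := Alphabet) (Sum.inl false) (fun (v : Mem) x => (v.1, v.2.1, x, v.2.2.2)) v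
    (mk I O A S T U C)
  rw [update_inp] at this
  exact this

/-- What a symbol of the input adds to the code of a list. -/
def symbolCode (x : Symbol) : List Bool := true :: (enc (symbolValue x)).code

open scoped Classical in
/-- Push the code of the last input symbol, provided that this symbol is in the list. -/
noncomputable def pushSymbol : List Symbol → P
  | [] => .load id
  | x :: l => .ite (fun v => decide (v.2.2.1 = some x)) (pushWord (symbolCode x)) (pushSymbol l)

theorem length_symbolCode (x : Symbol) : (symbolCode x).length ≤ 10 := by
  rcases x with _ | _ | (_ | _) | _ <;>
    simp [symbolCode, symbolValue, enc, encList, Tr.ofBool, Tr.code]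

theorem run_pushSymbol (I O A S T U C) {x : Symbol} {l : List Symbol} (hx : x ∈ l) (v : Mem)
    (hv : v.2.2.1 = some x) : ∃ m ≤ l.length + 11, ∃ v',
      Run (pushSymbol l) v (mk I O A S T U C) m v'
        (mk I O ((symbolCode x).map some ++ A) S T U C) := by
  induction l with
  | nil => simp at hx
  | cons y l ih =>
    by_cases hxy : x = y
    · subst hxy
      obtain ⟨m, hm, v', r⟩ := runs_pushWord I O A S T U C (symbolCode x) v
      have := length_symbolCode x
      exact ⟨m + 1, by simp; omega, v', .ite_true (by simp [hv]) r⟩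
    · obtain ⟨m, hm, v', r⟩ := ih ((List.mem_cons.1 hx).resolve_left hxy)
      exact ⟨m + 1, by simp; omega, v', .ite_false (by simp [hv, hxy]) r⟩

/-- All symbols. -/
def allSymbols : List Symbol := [.positive, .negative, .bit true, .bit false, .clauseEnd]

theorem mem_allSymbols (x : Symbol) : x ∈ allSymbols := by
  rcases x with _ | _ | (_ | _) | _ <;> simp [allSymbols]

/-- Read the input and make the list of its symbols, in reverse order, the current value. -/
noncomputable def readInput : P :=
  .seq (pushc 0 (some false)) (.seq popInput
    (.loop (fun v => v.2.2.1.isSome) (.seq (pushSymbol allSymbols) popInput)))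

/-- The symbol `some false` is the code of the empty list, and a word `symbolCode x` placed in front
of the code of `t` gives that of `symbolValue x :: t`; hence the reversal. A symbol costs at most 16
steps for the case distinction and the push, one for the pop and one for the loop test. -/
theorem runs_readInput (w : List Symbol) :
    Runs readInput (mk w [] [] [] [] [] [])
      (mk [] [] (enc (w.map symbolValue).reverse).stk [] [] [] []) (18 * w.length + 3) := by
  have key : ∀ (w : List Symbol) (t : List (List (Bool × Bool))) (v : Mem),
      ∃ m ≤ 18 * w.length + 1, ∃ v',
      Run (.loop (fun v => v.2.2.1.isSome) (.seq (pushSymbol allSymbols) popInput))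
        (v.1, v.2.1, w.head?, v.2.2.2) (mk w.tail [] (enc t).stk [] [] [] []) m v'
        (mk [] [] (enc ((w.map symbolValue).reverse ++ t)).stk [] [] [] []) := by
    intro w
    induction w with
    | nil => exact fun t v => ⟨1, le_rfl, _, .loop_done rfl⟩
    | cons x w ih =>
      intro t v
      obtain ⟨m₁, hm₁, v₁, r₁⟩ := run_pushSymbol w [] (enc t).stk [] [] [] [] (mem_allSymbols x)
        (v.1, v.2.1, some x, v.2.2.2) rfl
      obtain ⟨m₂, hm₂, v₂, r₂⟩ := ih (symbolValue x :: t) v₁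
      have e : (symbolCode x).map some ++ (enc t).stk = (enc (symbolValue x :: t)).stk := by
        simp [symbolCode, Tr.stk, enc, encList, Tr.code]
      rw [e] at r₁
      refine ⟨m₁ + 1 + m₂ + 1, ?_, v₂, .loop_step rfl (.seq r₁ (run_popInput ..)) ?_⟩
      · simp [allSymbols] at hm₁ ⊢; omega
      · simpa using r₂
  intro v
  obtain ⟨m₁, hm₁, v₁, r₁⟩ := runs_pushc0 w [] [] [] [] [] [] (some false) v
  obtain ⟨m₂, hm₂, v₂, r₂⟩ := key w [] v₁
  refine ⟨m₁ + (1 + m₂), by omega, v₂, .seq r₁ (.seq (run_popInput ..) ?_)⟩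
  rw [List.append_nil] at r₂
  exact r₂

/-- The initial memory. -/
def initMem : Mem := (none, none, none, false)

/-- Output the truth value that is the current value, and tidy up. -/
def writeOutput : P :=
  .seq (popw 0) (.seq (.push (Sum.inl true) isNode)
    (.seq (drain 0 (.load id)) (.load fun _ => initMem)))

theorem run_writeOutput (b : Bool) (v : Mem) : ∃ m ≤ 12,
    Run writeOutput v (mk [] [] (enc b).stk [] [] [] []) m initMem (mk [] [b] [] [] [] [] []) := by
  have h : (enc b).stk = some b :: (if b then [false, false] else []).map some := by
    cases b <;> rfl
  have h₁ := run_popw0 [] [] (enc b).stk [] [] [] [] v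
  rw [h] at h₁ ⊢
  have h₂ := Run.push (Γ := Alphabet) (Sum.inl true) isNode (some (some b), v.2)
    (mk [] [] ((if b then [false, false] else []).map some) [] [] [] [])
  have hb : isNode (some (some b), v.2) = b := by cases b <;> rfl
  rw [update_out, hb] at h₂
  obtain ⟨m, hm, v', h₃⟩ := runs_clear0 [] [b] [] [] [] [] (if b then [false, false] else [])
    (some (some b), v.2)
  exact ⟨1 + (1 + (m + 1)), by cases b <;> simp at hm <;> omega, .seq h₁ (.seq h₂ (.seq h₃ (.load ..)))⟩

/-- The machine on a program that decides a property of the list of input symbols. -/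
theorem outputs_of_computes {p : P} {w : List Symbol} {b : Bool} {n m : ℕ}
    (h : Computes p (enc (w.map symbolValue).reverse) (enc b) n)
    (hm : 18 * w.length + n + 15 ≤ m) :
    Nonempty (TM2OutputsInTime
      (machine (Γ := Alphabet) (Sum.inl false) (Sum.inl true) initMem
        (.seq readInput (.seq p writeOutput))) w (some [b]) m) := by
  obtain ⟨m₁, hm₁, v₁, r₁⟩ := runs_readInput w initMem
  obtain ⟨m₂, hm₂, v₂, r₂⟩ := h [] [] v₁
  obtain ⟨m₃, hm₃, r₃⟩ := run_writeOutput b v₂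
  refine machine_outputs (Γ := Alphabet) (k₀ := Sum.inl false) (k₁ := Sum.inl true)
    (n := m₁ + (m₂ + m₃)) (l := w) (l' := [b]) ?_ (by omega)
  rw [← mk_nil, update_inp, update_out]
  exact .seq r₁ (.seq r₂ r₃)

theorem sz_le_length_encodeCNF (F : CNF) : sz F ≤ 6 * (encodeCNF F).length + 1 := by
  have hbits : ∀ l : List Bool, sz l ≤ 4 * l.length + 1 := by
    intro l
    induction l with
    | nil => simp
    | cons b l ih =>
      have := sz_bool b
      simp; omega
  have hlit : ∀ l : Literal, sz l + 1 ≤ 6 * (encodeLiteral l).length := by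
    intro l
    have h₁ : sz l.1 ≤ 4 * l.1.bits.length + 1 := hbits l.1.bits
    have h₂ := sz_bool l.2
    simp [encodeLiteral]
    omega
  have hC : ∀ C : Clause, sz C ≤ 6 * (C.flatMap encodeLiteral).length + 1 := by
    intro C
    induction C with
    | nil => simp
    | cons l C ih =>
      have := hlit l
      rw [List.flatMap_cons, List.length_append, sz_cons]
      omega
  induction F with
  | nil => simp
  | cons C F ih =>
    have := hC C
    have e : encodeCNF (C :: F) = encodeClause C ++ encodeCNF F := rfl
    rw [e, encodeClause, sz_cons, List.length_append, List.length_append, List.length_singleton]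
    omega

theorem sz_symbols_le (w : List Symbol) :
    sz (w.map symbolValue).reverse ≤ 10 * w.length + 1 := by
  rw [sz_reverse]
  refine (sz_list_le (B := 9) fun a ha => ?_).trans (by simp; omega)
  obtain ⟨x, -, rfl⟩ := List.mem_map.1 ha
  have := length_symbolCode x
  rw [symbolCode, List.length_cons, Tr.length_code] at this
  exact Nat.le_of_succ_le_succ this

/-- The quantity in which everything is polynomially bounded. -/
noncomputable def boundBase (F : CNF) : ℕ := 4 ^ (formulaWidth F + 1) * ((encodeCNF F).length + 1)

/-- The power of 4 dominates the width `w` itself, `2 ^ (w + 1)` and `3 ^ w`, which are the only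
ways in which the width enters the estimates. -/
theorem le_boundBase (F : CNF) : 4 ^ (formulaWidth F + 1) ≤ boundBase F :=
  Nat.le_mul_of_pos_right _ (by omega)

theorem polyIn_width : PolyIn boundBase formulaWidth :=
  PolyIn.self.mono fun F => ((Nat.lt_pow_self (by omega)).le.trans
    (Nat.pow_le_pow_right (by omega) (Nat.le_succ _))).trans (le_boundBase F)

theorem polyIn_two_pow : PolyIn boundBase fun F => 2 ^ (formulaWidth F + 1) :=
  PolyIn.self.mono fun F => (Nat.pow_le_pow_left (by omega) _).trans (le_boundBase F)

theorem polyIn_three_pow : PolyIn boundBase fun F => 3 ^ formulaWidth F :=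
  PolyIn.self.mono fun F => ((Nat.pow_le_pow_left (by omega) _).trans
    (Nat.pow_le_pow_right (by omega) (Nat.le_succ _))).trans (le_boundBase F)

theorem polyIn_length : PolyIn boundBase fun F => (encodeCNF F).length :=
  PolyIn.self.mono fun F => (Nat.le_succ _).trans (Nat.le_mul_of_pos_left _ (by positivity))

theorem polyIn_sz : PolyIn boundBase fun F => sz F :=
  (((PolyIn.const 6).mul polyIn_length).add (.const 1)).mono sz_le_length_encodeCNF

theorem polyIn_potential :
    PolyIn boundBase fun F => potential (formulaWidth F) (sz F) (F, [], []) := by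
  have hW := (polyIn_sz.mul polyIn_three_pow).add (.const 1)
  have hnv : PolyIn boundBase fun F => (vars F).toFinset.card :=
    polyIn_sz.mono fun F => (List.toFinset_card_le _).trans (length_vars_le F)
  exact ((hnv.mul ((polyIn_width.add (.const 1)).mul hW)).add (polyIn_width.mul hW)).mono
    fun F => by simp [potential]

theorem polyIn_candBound : PolyIn boundBase fun F => candBound (formulaWidth F) (sz F) := by
  have hK := polyIn_width.add (.const 1)
  unfold candBound
  exact (((((PolyIn.const 2).mul hK).add (.const 1)).add
    ((hK.mul (polyIn_sz.add (.const 1))).add (.const 1))).add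
    ((polyIn_two_pow.mul (((hK.mul (polyIn_sz.add (.const 5))).add (.const 1)).add
      (.const 1))).add (.const 1))).add (.const 2)

/-- The program is fixed before `F`; the width occurs in the analysis only, as the `K` of the
invariant. -/
theorem exists_program : ∃ (p : P) (b : CNF → ℕ), PolyIn boundBase b ∧ ∀ F, ∃ answer : Bool,
    (answer = true ↔ Satisfiable F) ∧
      Computes p (enc ((encodeCNF F).map symbolValue).reverse) (enc answer) (b F) := by
  obtain ⟨-, p₁, b₁, hb₁, hp₁⟩ := PT.parse
  obtain ⟨-, p₂, b₂, hb₂, hp₂⟩ : PT fun F : CNF => ((F, [], []) : State) := .pair .id (.const _)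
  obtain ⟨-, p₃, b₃, ⟨d₃, hb₃⟩, hp₃⟩ : PT fun q : State => hasVar q.1 := .hasVar (.fst .id)
  obtain ⟨-, p₄, b₄, ⟨d₄, hb₄⟩, hp₄⟩ := PT.step
  obtain ⟨-, p₅, b₅, ⟨d₅, hb₅⟩, hp₅⟩ : PT fun q : State => q.1.isEmpty := .isEmpty (.fst .id)
  let Φ : CNF → ℕ := fun F => potential (formulaWidth F) (sz F) (F, [], [])
  -- The bound of `Inv.sz_le` at the initial potential, plus 3 so that it also covers the truth
  -- value of the loop test.
  let B : CNF → ℕ := fun F => sz F + (2 * formulaWidth F + 1) +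
    (Φ F * (candBound (formulaWidth F) (sz F) + 1) + 1) + 5
  have hB : PolyIn boundBase B :=
    ((polyIn_sz.add (((PolyIn.const 2).mul polyIn_width).add (.const 1))).add
      ((polyIn_potential.mul (polyIn_candBound.add (.const 1))).add (.const 1))).add (.const 5)
  have hB' := hB.add (.const 2)
  have hw : PolyIn boundBase fun F => sz ((encodeCNF F).map symbolValue).reverse :=
    (((PolyIn.const 10).mul polyIn_length).add (.const 1)).mono fun F => sz_symbols_le _
  refine ⟨.seq p₁ (.seq p₂ (.seq (whileProg p₃ p₄) p₅)), _,
    (PolyIn.comp hb₁ hw).add ((PolyIn.comp hb₂ polyIn_sz).add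
      (((polyIn_potential.add (.const 1)).mul ((((PolyIn.const 2).mul
        ((hB'.pow d₃).add (hB'.pow d₄))).add ((PolyIn.const 16).mul hB)).add (.const 20))).add
        (hB'.pow d₅))), fun F => ?_⟩
  obtain ⟨N, hN, hlt, hNp, hI⟩ := exists_iterate (f := step) (p := fun q : State => hasVar q.1)
    (fun q => Inv.step) (Inv.init (hasNEO_formulaWidth F))
  have hsz : ∀ i ≤ N, sz (step^[i] (F, [], [])) + 3 ≤ B F := by
    intro i hi
    obtain ⟨h₁, h₂⟩ := hI i hi
    have h₃ := h₁.sz_le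
    have h₄ := Nat.mul_le_mul_right (candBound (formulaWidth F) (sz F) + 1) h₂
    simp only [B, Φ]
    omega
  refine ⟨(step^[N] (F, [], [])).1.isEmpty, ?_, ?_⟩
  · rw [← satisfiable_iff_of_not_hasVar hNp]
    exact (hI N le_rfl).1.sat
  · have h₁ := hp₁ ((encodeCNF F).map symbolValue).reverse
    rw [parse_encodeCNF, enc_toBits] at h₁
    have hloop := computes_while (c := p₃) (p := p₄) (N := N)
      (t := (B F + 2) ^ d₃ + (B F + 2) ^ d₄) (B := B F)
      (fun i => enc (step^[i] (F, [], []))) (fun i => enc (hasVar (step^[i] (F, [], [])).1))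
      (fun i hi => (hp₃ _).mono ((hb₃ _).trans (le_add_right
        (Nat.pow_le_pow_left (by have := hsz i hi; omega) _))))
      (fun i hi => by
        simp only [iterate_succ_apply']
        exact (hp₄ _).mono ((hb₄ _).trans (le_add_left
          (Nat.pow_le_pow_left (by have := hsz i hi.le; omega) _))))
      (fun i hi => by have := hsz i hi; simp only [sz] at this ⊢; omega)
      (fun i hi => by
        have h₁ := hsz i hi
        have h₂ := sz_bool (hasVar (step^[i] (F, [], [])).1)
        simp only [sz] at h₁ h₂ ⊢; omega)
      (fun i hi => by rw [hlt i hi]; simp [enc, Tr.ofBool])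
      (by rw [hNp]; rfl)
    refine h₁.seq ((hp₂ F).seq (Computes.seq (hloop.mono ?_) ((hp₅ _).mono ((hb₅ _).trans
      (Nat.pow_le_pow_left (by have := hsz N le_rfl; omega) _)))))
    exact Nat.mul_le_mul_right _ (Nat.succ_le_succ hN)

theorem computable_bound (d : ℕ) : Computable fun k : ℕ => (4 ^ (k + 1) + 2) ^ d := by
  have hpow : Primrec₂ fun m n : ℕ => m ^ n := Primrec₂.unpaired'.1 Nat.Primrec.pow
  exact (hpow.comp (Primrec.nat_add.comp (hpow.comp (.const 4) .succ) (.const 2))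
    (.const d)).to_comp

theorem isFixedParameterTractable_sat :
    IsFixedParameterTractable encodeCNF Satisfiable formulaWidth := by
  obtain ⟨p, b, hb, hp⟩ := exists_program
  obtain ⟨d, hd⟩ := (((PolyIn.const 18).mul polyIn_length).add hb).add (.const 15)
  refine ⟨⟨machine (Γ := Alphabet) (Sum.inl false) (Sum.inl true) initMem
    (.seq readInput (.seq p writeOutput)), Equiv.refl Symbol, Equiv.refl Bool⟩,
    fun k => (4 ^ (k + 1) + 2) ^ d, d, computable_bound d, fun F => ?_⟩
  obtain ⟨answer, ha, hF⟩ := hp F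
  refine ⟨answer, ha, ?_⟩
  have key := outputs_of_computes hF (m := (4 ^ (formulaWidth F + 1) + 2) ^ d *
    ((encodeCNF F).length + 1) ^ d) ((hd F).trans ?_)
  · have e : (encodeCNF F).map (Equiv.refl Symbol).symm = encodeCNF F := List.map_id _
    exact e.symm ▸ key
  -- Since `boundBase F + 2 ≤ (4 ^ (w + 1) + 2) * (|F| + 1)` for the width `w`, the `d`-th power
  -- splits into a function of `w` and a power of the length.
  · rw [← mul_pow]
    refine Nat.pow_le_pow_left ?_ _
    rw [boundBase, Nat.add_mul]
    omega

end StackProg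

theorem theorem5p13 :
    NestSetSAT.IsFixedParameterTractable
      NestSetSAT.encodeCNF NestSetSAT.Satisfiable NestSetSAT.formulaWidth :=
  StackProg.isFixedParameterTractable_sat
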